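/- **Setting.** Let $d\ge 1$, $L,R\in(0,1]$, $0<a\le b$, $b\ge 1$, $W>0$, and let $\mathcal D$ be a probability distribution of pairs $(x,y)\in\mathbb R^d\times\mathbb R$ with $\mathbb E[y^2]<\infty$ and $\mathbb E[xx^\top]\preccurlyeq I$. Assume that the marginal $\mathcal D_x$ is $(L,R)$-well-behaved: for every subspace $V\subseteq\mathbb R^d$ of dimension $1$ or $2$, the projection of $\mathcal D_x$ onto $V$, written in the coordinates of any orthonormal basis of $V$, has a density $\gamma_V$ with $\gamma_V(z)\ge L$ whenever $\|z\|_\infty\le R$ and $\gamma_V(z)\le \frac1L e^{-L\|z\|_2}$ for all $z$. Let $\mathcal U_{(a,b)}$ be the set of functions $u:\mathbb R\to\mathbb R$ that are non-decreasing and $b$-Lipschitz, with $u(0)=0$ and $u(z)-u(z')\ge a(z-z')$ for all $z\ge z'\ge 0$. Let $\mathcal B(W)=\{w\in\mathbb R^d:\|w\|_2\le W\}$, $\mathcal L_2(w;u)=\mathbb E_{(x,y)\sim\mathcal D}[(u(w\cdot x)-y)^2]$ and $\mathrm{OPT}=\inf_{w\in\mathcal B(W),\,u\in\mathcal U_{(a,b)}}\mathcal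 L_2(w;u)$, and let $w^*\in\mathcal B(W)$, $u^*\in\mathcal U_{(a,b)}$ satisfy $\mathcal L_2(w^*;u^*)=\mathrm{OPT}$. For a sample $S=\{(x^{(i)},y^{(i)})\}_{i=1}^m$, the empirical surrogate loss is $\widehat{\mathcal L}_{\mathrm{sur}}(w;u)=\frac1m\sum_{i=1}^m\int_0^{w\cdot x^{(i)}}(u(r)-y^{(i)})\,dr$, with gradient in $w$ equal to $\nabla\widehat{\mathcal L}_{\mathrm{sur}}(w;u)=\frac1m\sum_{i=1}^m(u(w\cdot x^{(i)})-y^{(i)})\,x^{(i)}$. Write $v^{\perp_w}=v-\frac{v\cdot w}{\|w\|_2^2}w$ for $w\ne0$, and $v^{\perp_0}=v$. **Proposition 3.1 (Alignment Sharpness of the Convex Surrogate).** There are universal constants $c,C>0$ such that the following holds in the above setting, with $\mu=c\,a^2LR^4/b$. Let $0<\varepsilon\le1$, $0<\delta\le\frac12$, let $w\in\mathcal B(W)$, and let $S$ consist of $m$ i.i.d. samples from $\mathcal D$, where $$m\ \ge\ C\,d\,\max(1,W)^{9/2}\,b^4L^{-4}\,\log^4\!\Big(\frac{d}{\varepsilon\delta}\Big)\Big(\frac1{\varepsilon^{3/2}}+\frac1{\varepsilon\delta}\Big).$$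 Then, with probability at least $1-\delta$, every $\hat u\in\operatorname{argmin}_{u\in\mathcal U_{(a,b)}}\frac1m\sum_{i=1}^m(u(w\cdot x^{(i)})-y^{(i)})^2$ satisfies $$\nabla\widehat{\mathcal L}_{\mathrm{sur}}(w;\hat u)\cdot(w-w^*)\ \ge\ \mu\,\|(w^*)^{\perp_w}\|_2^2-\frac{2(\mathrm{OPT}+\varepsilon)}b-2\big(\sqrt{\mathrm{OPT}}+\sqrt{\varepsilon}\big)\|w-w^*\|_2 .$$ -/

import Mathlib

open MeasureTheory
open scoped RealInnerProductSpace

noncomputable section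

namespace SIM

/-- A distribution `P` on `ℝ^d` is `(L, R)`-well-behaved: for every subspace `V` of dimension
`1` or `2`, the projection of `P` onto `V`, written in the coordinates of any orthonormal
basis `e` of `V`, has a density `γ` with respect to Lebesgue measure such that `γ ≥ L` on the
sup-norm ball of radius `R` and `γ z ≤ (1 / L) * exp (-L * ‖z‖₂)` everywhere. -/
def IsWellBehaved {d : ℕ} (L R : ℝ) (P : Measure (EuclideanSpace ℝ (Fin d))) : Prop :=
  ∀ k : ℕ, 1 ≤ k → k ≤ 2 →
    ∀ e : Fin k → EuclideanSpace ℝ (Fin d), Orthonormal ℝ e →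
      ∃ γ : EuclideanSpace ℝ (Fin k) → ℝ,
        Measurable γ ∧ (∀ z, 0 ≤ γ z) ∧
        P.map (fun x => WithLp.toLp 2 (fun i => ⟪e i, x⟫))
          = volume.withDensity (fun z => ENNReal.ofReal (γ z)) ∧
        (∀ z, (∀ i, |z i| ≤ R) → L ≤ γ z) ∧
        (∀ z, γ z ≤ 1 / L * Real.exp (-L * ‖z‖))

/-- `E[x xᵀ] ≼ I`, as an inequality of quadratic forms. -/
def SecondMomentLeOne {d : ℕ} (P : Measure (EuclideanSpace ℝ (Fin d))) : Prop :=
  ∀ v : EuclideanSpace ℝ (Fin d), ∫ x, ⟪v, x⟫ ^ 2 ∂P ≤ ‖v‖ ^ 2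

/-- The class of `(a, b)`-unbounded activations. -/
def activations (a b : ℝ) : Set (ℝ → ℝ) :=
  {u | u 0 = 0 ∧ Monotone u ∧ (∀ z z', |u z - u z'| ≤ b * |z - z'|) ∧
    ∀ z z', 0 ≤ z' → z' ≤ z → a * (z - z') ≤ u z - u z'}

/-- The population squared loss `E[(u(w · x) - y)²]`. -/
def sqLoss {d : ℕ} (D : Measure (EuclideanSpace ℝ (Fin d) × ℝ))
    (w : EuclideanSpace ℝ (Fin d)) (u : ℝ → ℝ) : ℝ :=
  ∫ p, (u ⟪w, p.1⟫ - p.2) ^ 2 ∂D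

/-- `OPT`, the best squared loss over `‖w‖ ≤ W` and `(a, b)`-unbounded activations `u`. -/
def opt {d : ℕ} (D : Measure (EuclideanSpace ℝ (Fin d) × ℝ)) (a b W : ℝ) : ℝ :=
  sInf {r | ∃ w : EuclideanSpace ℝ (Fin d), ∃ u : ℝ → ℝ,
    ‖w‖ ≤ W ∧ u ∈ activations a b ∧ r = sqLoss D w u}

/-- `(w, u)` attains `OPT`. -/
def IsOptimal {d : ℕ} (D : Measure (EuclideanSpace ℝ (Fin d) × ℝ)) (a b W : ℝ)
    (w : EuclideanSpace ℝ (Fin d)) (u : ℝ → ℝ) : Prop :=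
  ‖w‖ ≤ W ∧ u ∈ activations a b ∧ sqLoss D w u = opt D a b W

/-- The empirical squared loss of `u(w · x)` on the sample `S`. -/
def empSqLoss {d m : ℕ} (S : Fin m → EuclideanSpace ℝ (Fin d) × ℝ)
    (w : EuclideanSpace ℝ (Fin d)) (u : ℝ → ℝ) : ℝ :=
  (1 / (m : ℝ)) * ∑ i, (u ⟪w, (S i).1⟫ - (S i).2) ^ 2

/-- `u` is an empirical best-fit activation for the parameter `w` on the sample `S`: it minimizes
the empirical squared loss over all `(a, b)`-unbounded activations. -/
def IsBestFit {d m : ℕ} (a b : ℝ) (S : Fin m → EuclideanSpace ℝ (Fin d) × ℝ)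
    (w : EuclideanSpace ℝ (Fin d)) (u : ℝ → ℝ) : Prop :=
  u ∈ activations a b ∧ ∀ v ∈ activations a b, empSqLoss S w u ≤ empSqLoss S w v

/-- The empirical surrogate loss `(1/m) ∑ᵢ ∫₀^{w · xᵢ} (u(r) - yᵢ) dr`. -/
def empSurrogateLoss {d m : ℕ} (S : Fin m → EuclideanSpace ℝ (Fin d) × ℝ)
    (w : EuclideanSpace ℝ (Fin d)) (u : ℝ → ℝ) : ℝ :=
  (1 / (m : ℝ)) * ∑ i, ∫ r in (0 : ℝ)..⟪w, (S i).1⟫, (u r - (S i).2)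

/-- The gradient in `w` of the empirical surrogate loss, `(1/m) ∑ᵢ (u(w · xᵢ) - yᵢ) xᵢ`. -/
def empSurrogateGrad {d m : ℕ} (S : Fin m → EuclideanSpace ℝ (Fin d) × ℝ)
    (w : EuclideanSpace ℝ (Fin d)) (u : ℝ → ℝ) : EuclideanSpace ℝ (Fin d) :=
  (1 / (m : ℝ)) • ∑ i, (u ⟪w, (S i).1⟫ - (S i).2) • (S i).1

/-- `empSurrogateGrad` is indeed the gradient of `empSurrogateLoss` in `w`, with `u` fixed. -/
theorem hasGradientAt_empSurrogateLoss {d m : ℕ}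
    (S : Fin m → EuclideanSpace ℝ (Fin d) × ℝ) (w : EuclideanSpace ℝ (Fin d))
    (u : ℝ → ℝ) (hu : Continuous u) :
    HasGradientAt (fun v => empSurrogateLoss S v u) (empSurrogateGrad S w u) w := by
  rw [hasGradientAt_iff_hasFDerivAt]
  have h : ∀ i : Fin m, HasFDerivAt
      (fun v : EuclideanSpace ℝ (Fin d) => ∫ r in (0 : ℝ)..⟪v, (S i).1⟫, (u r - (S i).2))
      ((u ⟪w, (S i).1⟫ - (S i).2) • innerSL ℝ (S i).1) w := by
    intro i
    have hc : Continuous fun r => u r - (S i).2 := hu.sub continuous_const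
    have h1 := intervalIntegral.integral_hasDerivAt_right (hc.intervalIntegrable 0 ⟪w, (S i).1⟫)
      hc.aestronglyMeasurable.stronglyMeasurableAtFilter hc.continuousAt
    have h2 : HasFDerivAt (fun v : EuclideanSpace ℝ (Fin d) => ⟪v, (S i).1⟫)
        (innerSL ℝ (S i).1) w := by
      have := (innerSL ℝ (S i).1).hasFDerivAt (x := w)
      refine this.congr_of_eventuallyEq (Filter.Eventually.of_forall fun v => ?_)
      simp [real_inner_comm]
    exact h1.comp_hasFDerivAt w h2
  have hs := (HasFDerivAt.fun_sum (u := Finset.univ) fun i _ => h i).const_mul (1 / (m : ℝ))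
  refine hs.congr_fderiv ?_
  ext v
  simp [empSurrogateGrad]

/-- The component of `v` orthogonal to `u`; it is `v` itself when `u = 0`. -/
def perp {d : ℕ} (v u : EuclideanSpace ℝ (Fin d)) : EuclideanSpace ℝ (Fin d) :=
  v - (⟪v, u⟫ / ‖u‖ ^ 2) • u

end SIM

end

/-! Write `z = w · x`, `t = w* · x`, `f = u*`, and let `ξ = y - f t` be the noise, so `E ξ² = OPT`.
The class of activations is convex and `w` is fixed, so the best fit is a projection in the sample
space: it satisfies a variational inequality and is firmly nonexpansive in the labels. Let `u'` be
the best fit to the noiseless labels `f t`, and split `ξ = ξ₁ + ξ₂` into its low and high parts. The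
quantity to bound is the sample mean of `(u' z - f t)(z - t) + (u z - u' z - ξ₁)(z - t) - ξ₂ (z -
t)`.

Signal. Testing the optimality of `u'` against `f ∘ k`, where formally `k = f⁻¹ ∘ u'`, allows `z` to
be replaced by `k z`. Cocoercivity of `f` then gives `1 / b` times a squared error. Since `f` may be
flat on the negative axis, `f` is regularized to `f + η id` and `η` tends to `0`
(`exists_proximal_activation`, `bestFit_noiseless_alignment`). The squared error of any activation
of `z` against `f t` is at least of order `a² L R⁴ ‖(w*)^⊥‖²`: on a thin strip in the direction of
`w` the activation is almost constant while `f t` varies in the orthogonal direction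
(`exists_error_cells`). Only the frequencies of finitely many cells matter, so the bound is uniform
over activations.

Noise. Only `E ξ² < ∞` is known. The square of the bounded part `ξ₁` concentrates by Chebyshev, and
firm nonexpansiveness bounds `u - u' - ξ₁` in mean square by `E ξ₁²` plus the correlation of `ξ₂`
with `u - u'`. That correlation is bounded uniformly over Lipschitz functions by writing them as
integrals of their derivatives (`abs_sum_mul_le_of_lipschitz`), which needs a second moment only.
Cauchy–Schwarz and `E ξ₁² + E ξ₂² = OPT` keep the total factor of `√OPT` below `2` (`noise_budget`).
-/

namespace SIM

/-! ### Best fits as projections onto a convex class of activations -/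

section Activations

variable {a b : ℝ}

theorem activations_convex {u v : ℝ → ℝ} (hu : u ∈ activations a b) (hv : v ∈ activations a b)
    {s : ℝ} (hs0 : 0 ≤ s) (hs1 : s ≤ 1) : (fun z => u z + s * (v z - u z)) ∈ activations a b := by
  obtain ⟨u0, um, ul, ua⟩ := hu
  obtain ⟨v0, vm, vl, va⟩ := hv
  refine ⟨by simp [u0, v0], ?_, ?_, ?_⟩
  · intro x y hxy
    have h1 := um hxy
    have h2 := vm hxy
    have h3 := mul_nonneg (sub_nonneg.2 hs1) (sub_nonneg.2 h1)
    have h4 := mul_nonneg hs0 (sub_nonneg.2 h2)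
    simp only
    linarith
  · intro x y
    have h1 := ul x y
    have h2 := vl x y
    have e : u x + s * (v x - u x) - (u y + s * (v y - u y))
        = (1 - s) * (u x - u y) + s * (v x - v y) := by ring
    simp only [e]
    calc |(1 - s) * (u x - u y) + s * (v x - v y)|
        ≤ |(1 - s) * (u x - u y)| + |s * (v x - v y)| := abs_add_le _ _
      _ = (1 - s) * |u x - u y| + s * |v x - v y| := by
          rw [abs_mul, abs_mul, abs_of_nonneg hs0, abs_of_nonneg (sub_nonneg.2 hs1)]
      _ ≤ (1 - s) * (b * |x - y|) + s * (b * |x - y|) :=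
          add_le_add (mul_le_mul_of_nonneg_left h1 (sub_nonneg.2 hs1))
            (mul_le_mul_of_nonneg_left h2 hs0)
      _ = b * |x - y| := by ring
  · intro x y hy hxy
    have h3 := mul_le_mul_of_nonneg_left (ua x y hy hxy) (sub_nonneg.2 hs1)
    have h4 := mul_le_mul_of_nonneg_left (va x y hy hxy) hs0
    simp only
    linarith

theorem abs_le_of_mem_activations {u : ℝ → ℝ} (hu : u ∈ activations a b) (z : ℝ) :
    |u z| ≤ b * |z| := by
  simpa [hu.1] using hu.2.2.1 z 0

theorem continuous_of_mem_activations {u : ℝ → ℝ} (hu : u ∈ activations a b) : Continuous u := by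
  have : LipschitzWith b.toNNReal u := LipschitzWith.of_dist_le_mul fun x y => by
    rw [Real.dist_eq, Real.dist_eq]
    exact (hu.2.2.1 x y).trans (mul_le_mul_of_nonneg_right (Real.le_coe_toNNReal b) (abs_nonneg _))
  exact this.continuous

/-- Compactness is in the topology of pointwise convergence: every defining condition is closed, and
values at `z` stay within `b * |z|`, so Tychonoff applies. Best fits exist because the loss depends
on finitely many values only. -/
theorem isCompact_activations : IsCompact (activations a b) := by
  have hK : IsCompact (Set.pi Set.univ fun z : ℝ => Set.Icc (-(b * |z|)) (b * |z|)) :=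
    isCompact_univ_pi fun _ => isCompact_Icc
  refine hK.of_isClosed_subset ?_ ?_
  · have e : activations a b = {u : ℝ → ℝ | u 0 = 0} ∩
        ((⋂ x, ⋂ y, ⋂ (_ : x ≤ y), {u : ℝ → ℝ | u x ≤ u y}) ∩
        ((⋂ x, ⋂ y, {u : ℝ → ℝ | |u x - u y| ≤ b * |x - y|}) ∩
        ⋂ x, ⋂ y, ⋂ (_ : 0 ≤ y), ⋂ (_ : y ≤ x), {u : ℝ → ℝ | a * (x - y) ≤ u x - u y})) := by
      ext u
      simp [activations, Monotone]
    rw [e]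
    refine IsClosed.inter (isClosed_eq (by fun_prop) (by fun_prop)) (IsClosed.inter ?_
      (IsClosed.inter ?_ ?_))
    · exact isClosed_iInter fun x => isClosed_iInter fun y => isClosed_iInter fun _ =>
        isClosed_le (by fun_prop) (by fun_prop)
    · exact isClosed_iInter fun x => isClosed_iInter fun y =>
        isClosed_le (by fun_prop) (by fun_prop)
    · exact isClosed_iInter fun x => isClosed_iInter fun y => isClosed_iInter fun _ =>
        isClosed_iInter fun _ => isClosed_le (by fun_prop) (by fun_prop)
  · intro u hu z _
    exact abs_le.1 (abs_le_of_mem_activations hu z)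

theorem exists_bestFit {ι : Type*} [Fintype ι] (z y : ι → ℝ) {u₀ : ℝ → ℝ}
    (hu₀ : u₀ ∈ activations a b) :
    ∃ u ∈ activations a b, ∀ v ∈ activations a b,
      ∑ i, (u (z i) - y i) ^ 2 ≤ ∑ i, (v (z i) - y i) ^ 2 := by
  obtain ⟨u, hu, hmin⟩ := (isCompact_activations (a := a) (b := b)).exists_isMinOn ⟨u₀, hu₀⟩
    (f := fun u : ℝ → ℝ => ∑ i, (u (z i) - y i) ^ 2) (by fun_prop)
  exact ⟨u, hu, fun v hv => hmin hv⟩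

/-- First-order optimality of the best fit over a convex class. -/
theorem bestFit_variational {ι : Type*} [Fintype ι] {z y : ι → ℝ} {u v : ℝ → ℝ}
    (hu : u ∈ activations a b) (hv : v ∈ activations a b)
    (hmin : ∀ v ∈ activations a b, ∑ i, (u (z i) - y i) ^ 2 ≤ ∑ i, (v (z i) - y i) ^ 2) :
    ∑ i, (u (z i) - y i) * (u (z i) - v (z i)) ≤ 0 := by
  set A := ∑ i, (u (z i) - y i) * (u (z i) - v (z i)) with hA
  set B := ∑ i, (v (z i) - u (z i)) ^ 2 with hB
  have key : ∀ s : ℝ, 0 ≤ s → s ≤ 1 → 0 ≤ s * (s * B - 2 * A) := by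
    intro s h0 h1
    have h := hmin _ (activations_convex hu hv h0 h1)
    have e : ∑ i, (u (z i) + s * (v (z i) - u (z i)) - y i) ^ 2
        = ∑ i, (u (z i) - y i) ^ 2 + s * (s * B - 2 * A) := by
      rw [hA, hB, Finset.mul_sum, Finset.mul_sum, ← Finset.sum_sub_distrib, Finset.mul_sum,
        ← Finset.sum_add_distrib]
      exact Finset.sum_congr rfl fun i _ => by ring
    rw [e] at h
    linarith
  by_contra! hpos
  have hB0 : 0 ≤ B := Finset.sum_nonneg fun i _ => sq_nonneg _
  -- If `A` were positive, this step length would keep `s * B ≤ A`, so moving towards `v` would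
  -- strictly decrease the loss.
  have hs : 0 < A / (A + B) := by positivity
  have h := key (A / (A + B)) hs.le (by rw [div_le_one (by positivity)]; linarith)
  have h2 : A / (A + B) * B ≤ A := by
    rw [div_mul_eq_mul_div, div_le_iff₀ (by positivity)]
    nlinarith
  nlinarith [mul_pos hs hpos]

/-- The proximal transform of `u` along `f`: a member of the class of the form `f ∘ k` with
`f (k z) + η * k z = u z + η * z`. -/
theorem exists_proximal_activation {u f : ℝ → ℝ} (ha : 0 < a) (hu : u ∈ activations a b)
    (hf : f ∈ activations a b) {η : ℝ} (hη : 0 < η) :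
    ∃ k : ℝ → ℝ, (fun z => f (k z)) ∈ activations a b ∧ ∀ z, f (k z) + η * k z = u z + η * z := by
  obtain ⟨u0, um, ul, ua⟩ := hu
  have hfc := continuous_of_mem_activations hf
  obtain ⟨f0, fm, fl, fa⟩ := hf
  -- The term `η * k` makes the map strictly increasing and coercive even where `f` is flat, so the
  -- equation for `k z` is solvable.
  have surj : Function.Surjective fun k => f k + η * k := by
    refine Continuous.surjective (by fun_prop) ?_ ?_
    · refine Filter.tendsto_atTop_mono' _ ?_ (Filter.tendsto_id.const_mul_atTop hη)
      filter_upwards [Filter.eventually_ge_atTop 0] with x hx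
      have := fm hx
      simp only [id]
      linarith
    · refine Filter.tendsto_atBot_mono' _ ?_ (Filter.tendsto_id.const_mul_atBot hη)
      filter_upwards [Filter.eventually_le_atBot 0] with x hx
      have := fm hx
      simp only [id]
      linarith
  choose k hk using fun z => surj (u z + η * z)
  simp only at hk
  have kinj : ∀ {x y}, f x + η * x ≤ f y + η * y → x ≤ y := by
    intro x y h
    by_contra! hlt
    have := fm hlt.le
    nlinarith
  have kmono : Monotone k := by
    intro x y hxy
    apply kinj
    rw [hk, hk]
    have := um hxy
    nlinarith
  have k0 : k 0 = 0 := by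
    have h := hk 0
    simp only [u0, mul_zero, add_zero] at h
    apply le_antisymm <;> apply kinj <;> simp [f0, h]
  -- If `f ∘ k` rose faster than slope `b`, hence faster than `u`, the defining equation would force
  -- `k` to rise more slowly than the identity. The Lipschitz bound on `f` then contradicts the fast
  -- rise.
  have upper : ∀ x y, y ≤ x → f (k x) - f (k y) ≤ b * (x - y) := by
    intro x y hxy
    by_contra! h
    have h1 := ul x y
    have h2 := fl (k x) (k y)
    rw [abs_of_nonneg (sub_nonneg.2 hxy)] at h1
    rw [abs_of_nonneg (sub_nonneg.2 (kmono hxy))] at h2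
    have h3 := hk x
    have h4 := hk y
    have h5 := (le_abs_self _).trans h1
    have h6 := (le_abs_self _).trans h2
    have h7 : η * (k x - k y) < η * (x - y) := by linarith
    have h8 : k x - k y < x - y := lt_of_mul_lt_mul_left h7 hη.le
    rcases le_or_gt 0 b with hb | hb
    · nlinarith [mul_le_mul_of_nonneg_left h8.le hb]
    · have := kmono hxy
      have := um hxy
      nlinarith
  refine ⟨k, ⟨by simp [k0, f0], fun x y h => fm (kmono h), ?_, ?_⟩, hk⟩
  · intro x y
    rcases le_total y x with h | h
    · rw [abs_of_nonneg (sub_nonneg.2 (fm (kmono h))), abs_of_nonneg (sub_nonneg.2 h)]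
      exact upper x y h
    · rw [abs_sub_comm, abs_sub_comm x, abs_of_nonneg (sub_nonneg.2 (fm (kmono h))),
        abs_of_nonneg (sub_nonneg.2 h)]
      exact upper y x h
  · intro x y hy hxy
    -- Mirror argument: too small a rise of `f ∘ k` forces a small rise of `k`, since `f` has slope
    -- at least `a` to the right of `k 0 = 0`. The sum `f ∘ k + η k` then rises less than `u + η
    -- id`.
    by_contra! h
    have ky : 0 ≤ k y := by simpa [k0] using kmono hy
    have h1 := ua x y hy hxy
    have h2 := fa (k x) (k y) ky (kmono hxy)
    have h8 : k x - k y < x - y := lt_of_mul_lt_mul_left (h2.trans_lt h) ha.le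
    have h3 := hk x
    have h4 := hk y
    nlinarith [mul_lt_mul_of_pos_left h8 hη]

/-- Monotone `b`-Lipschitz functions are `1 / b`-cocoercive. -/
theorem sq_sub_le_of_mem_activations {u : ℝ → ℝ} (hb : 0 < b) (hu : u ∈ activations a b)
    (s t : ℝ) : 1 / b * (u s - u t) ^ 2 ≤ (u s - u t) * (s - t) := by
  have h := hu.2.2.1 s t
  have e : (u s - u t) * (s - t) = |u s - u t| * |s - t| := by
    rw [← abs_mul]
    symm
    apply abs_of_nonneg
    rcases le_total s t with hst | hst
    · exact mul_nonneg_of_nonpos_of_nonpos (sub_nonpos.2 (hu.2.1 hst)) (sub_nonpos.2 hst)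
    · exact mul_nonneg (sub_nonneg.2 (hu.2.1 hst)) (sub_nonneg.2 hst)
  rw [e, ← sq_abs, one_div_mul_eq_div, div_le_iff₀ hb]
  nlinarith [abs_nonneg (u s - u t)]

/-- Alignment of the noiseless best fit, up to an arbitrarily small quadratic term. -/
theorem bestFit_noiseless_alignment {ι : Type*} [Fintype ι] {z t : ι → ℝ} {u f : ℝ → ℝ}
    (ha : 0 < a) (hb : 0 < b) (hu : u ∈ activations a b) (hf : f ∈ activations a b)
    (hmin : ∀ v ∈ activations a b, ∑ i, (u (z i) - f (t i)) ^ 2 ≤ ∑ i, (v (z i) - f (t i)) ^ 2)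
    {η : ℝ} (hη : 0 < η) :
    ∃ v ∈ activations a b, 1 / b * ∑ i, (v (z i) - f (t i)) ^ 2
      - η / 4 * ∑ i, (z i - t i) ^ 2 ≤ ∑ i, (u (z i) - f (t i)) * (z i - t i) := by
  obtain ⟨k, hv, hk⟩ := exists_proximal_activation ha hu hf hη
  refine ⟨_, hv, ?_⟩
  have h := bestFit_variational hu hv hmin
  -- Since `u - f ∘ k = η (k - id)`, optimality of `u` tested against `f ∘ k` becomes a comparison
  -- of `k z` with `z`.
  have h' : ∑ i, (u (z i) - f (t i)) * (k (z i) - z i) ≤ 0 := by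
    have e : ∑ i, (u (z i) - f (t i)) * (u (z i) - f (k (z i)))
        = η * ∑ i, (u (z i) - f (t i)) * (k (z i) - z i) := by
      rw [Finset.mul_sum]
      refine Finset.sum_congr rfl fun i _ => ?_
      have : u (z i) - f (k (z i)) = η * (k (z i) - z i) := by linarith [hk (z i)]
      rw [this]; ring
    rw [e] at h
    by_contra! hc
    nlinarith [mul_pos hη hc]
  have h2 : 1 / b * ∑ i, (f (k (z i)) - f (t i)) ^ 2 - η / 4 * ∑ i, (z i - t i) ^ 2
      ≤ ∑ i, (u (z i) - f (t i)) * (k (z i) - t i) := by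
    rw [Finset.mul_sum, Finset.mul_sum, ← Finset.sum_sub_distrib]
    refine Finset.sum_le_sum fun i _ => ?_
    have h1 := sq_sub_le_of_mem_activations hb hf (k (z i)) (t i)
    have e : u (z i) - f (t i) = (f (k (z i)) - f (t i)) + η * (k (z i) - z i) := by
      linarith [hk (z i)]
    rw [e]
    -- Completing the square: `(k - z)(k - t) = (k - t - (z - t) / 2)² - (z - t)² / 4`.
    nlinarith [mul_nonneg hη.le (sq_nonneg (k (z i) - t i - (z i - t i) / 2))]
  have h3 : ∑ i, (u (z i) - f (t i)) * (k (z i) - t i)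
      = ∑ i, (u (z i) - f (t i)) * (k (z i) - z i) + ∑ i, (u (z i) - f (t i)) * (z i - t i) := by
    rw [← Finset.sum_add_distrib]
    exact Finset.sum_congr rfl fun i _ => by ring
  linarith

/-- Nonexpansiveness of the best fit in the labels. -/
theorem bestFit_stability {ι : Type*} [Fintype ι] {z y y' : ι → ℝ} {u u' : ℝ → ℝ}
    (hu : u ∈ activations a b) (hu' : u' ∈ activations a b)
    (hmin : ∀ v ∈ activations a b, ∑ i, (u (z i) - y i) ^ 2 ≤ ∑ i, (v (z i) - y i) ^ 2)
    (hmin' : ∀ v ∈ activations a b, ∑ i, (u' (z i) - y' i) ^ 2 ≤ ∑ i, (v (z i) - y' i) ^ 2) :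
    ∑ i, (u (z i) - u' (z i)) ^ 2 ≤ ∑ i, (y i - y' i) * (u (z i) - u' (z i)) := by
  have h1 := bestFit_variational hu hu' hmin
  have h2 := bestFit_variational hu' hu hmin'
  have e : ∑ i, (u (z i) - u' (z i)) ^ 2 - ∑ i, (y i - y' i) * (u (z i) - u' (z i))
      = ∑ i, (u (z i) - y i) * (u (z i) - u' (z i))
        + ∑ i, (u' (z i) - y' i) * (u' (z i) - u (z i)) := by
    rw [← Finset.sum_sub_distrib, ← Finset.sum_add_distrib]
    exact Finset.sum_congr rfl fun i _ => by ring
  linarith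

end Activations

/-! ### Duality between Lipschitz functions and kernel sums -/

section Duality

/-- The kernel representing point evaluation: `g z - g 0 = ∫ g' t * stepKernel t z dt`. -/
noncomputable def stepKernel (t z : ℝ) : ℝ :=
  (Set.Ioc 0 z).indicator (fun _ => (1 : ℝ)) t - (Set.Ioc z 0).indicator (fun _ => (1 : ℝ)) t

theorem abs_stepKernel_le_one (t z : ℝ) : |stepKernel t z| ≤ 1 := by
  unfold stepKernel
  by_cases h1 : t ∈ Set.Ioc 0 z <;> by_cases h2 : t ∈ Set.Ioc z 0 <;> simp [h1, h2]

theorem measurable_stepKernel : Measurable fun p : ℝ × ℝ => stepKernel p.1 p.2 := by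
  have e : (fun p : ℝ × ℝ => stepKernel p.1 p.2) = fun p : ℝ × ℝ =>
      ({p : ℝ × ℝ | 0 < p.1} ∩ {p | p.1 ≤ p.2}).indicator (fun _ => (1 : ℝ)) p
      - ({p : ℝ × ℝ | p.2 < p.1} ∩ {p | p.1 ≤ 0}).indicator (fun _ => (1 : ℝ)) p := by
    funext p
    simp [stepKernel, Set.indicator, Set.mem_Ioc]
  rw [e]
  refine Measurable.sub (measurable_const.indicator ?_) (measurable_const.indicator ?_)
  · exact (measurableSet_lt (by fun_prop) (by fun_prop)).inter
      (measurableSet_le (by fun_prop) (by fun_prop))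
  · exact (measurableSet_lt (by fun_prop) (by fun_prop)).inter
      (measurableSet_le (by fun_prop) (by fun_prop))

/-- The kernel is the signed indicator of the segment from `0` to `z`, so this is the fundamental
theorem of calculus for absolutely continuous functions. The domain `(-B, B]` does not depend on
`z`, so sums over the sample can be taken under the integral. -/
theorem integral_deriv_mul_stepKernel {g : ℝ → ℝ} {K : NNReal} (hg : LipschitzWith K g)
    {B z : ℝ} (hz : |z| ≤ B) :
    ∫ t in Set.Ioc (-B) B, deriv g t * stepKernel t z = g z - g 0 := by
  obtain ⟨hz1, hz2⟩ := abs_le.1 hz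
  have hac : AbsolutelyContinuousOnInterval g 0 z :=
    hg.lipschitzOnWith.absolutelyContinuousOnInterval
  rw [← hac.integral_deriv_eq_sub, intervalIntegral.intervalIntegral_eq_integral_uIoc]
  have hint : ∀ x y : ℝ, IntegrableOn (deriv g) (Set.Ioc x y) := by
    intro x y
    refine Measure.integrableOn_of_bounded (M := K) (by simp)
      (measurable_deriv g).aestronglyMeasurable (Filter.Eventually.of_forall fun t => ?_)
    exact norm_deriv_le_of_lipschitz hg
  rcases le_total 0 z with h | h
  · have e : (fun t => deriv g t * stepKernel t z) = (Set.Ioc 0 z).indicator (deriv g) := by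
      funext t
      have : Set.Ioc z 0 = ∅ := Set.Ioc_eq_empty (not_lt.2 h)
      simp [stepKernel, this, Set.indicator]
    rw [e, setIntegral_indicator measurableSet_Ioc, Set.Ioc_inter_Ioc, if_pos h, Set.uIoc_of_le h,
      max_eq_right (by linarith), min_eq_right hz2, one_smul]
  · have e : (fun t => deriv g t * stepKernel t z)
        = fun t => - (Set.Ioc z 0).indicator (deriv g) t := by
      funext t
      have : Set.Ioc 0 z = ∅ := Set.Ioc_eq_empty (not_lt.2 h)
      simp [stepKernel, this, Set.indicator]
    rw [e, integral_neg, setIntegral_indicator measurableSet_Ioc, Set.Ioc_inter_Ioc,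
      Set.uIoc_of_ge h, max_eq_right hz1, min_eq_right (by linarith)]
    rcases h.eq_or_lt with h | h
    · simp [h]
    · rw [if_neg (not_le.2 h)]; simp

/-- Weighted sums of a Lipschitz function are controlled by the deviation of the weighted
kernel sums from any bounded centering. -/
theorem abs_sum_mul_le_of_lipschitz {ι : Type*} [Fintype ι] {g : ℝ → ℝ} {K : NNReal}
    (hg : LipschitzWith K g) (hg0 : g 0 = 0) {c z : ι → ℝ} {B H T l : ℝ} (hB : 0 ≤ B)
    (hl : 0 < l) (hT : 0 ≤ T) (hz : ∀ i, |z i| ≤ B) {h : ℝ → ℝ} (hm : Measurable h)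
    (hH : ∀ t, |h t| ≤ H)
    (hdev : ∫⁻ t in Set.Ioc (-B) B, ENNReal.ofReal ((∑ i, c i * stepKernel t (z i) - h t) ^ 2)
      ≤ ENNReal.ofReal T) :
    |∑ i, c i * g (z i)| ≤ K * (T / (2 * l) + l * B) + 2 * K * B * H := by
  set Q : ℝ → ℝ := fun t => ∑ i, c i * stepKernel t (z i) with hQ
  have hQm : Measurable Q := by
    refine Finset.measurable_sum _ fun i _ => Measurable.const_mul ?_ _
    exact measurable_stepKernel.comp (measurable_id.prodMk measurable_const)
  have hdint : ∀ i, IntegrableOn (fun t => deriv g t * stepKernel t (z i)) (Set.Ioc (-B) B) := by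
    intro i
    refine Measure.integrableOn_of_bounded (M := K) (by simp) ?_
      (Filter.Eventually.of_forall fun t => ?_)
    · exact ((measurable_deriv g).mul
        (measurable_stepKernel.comp (measurable_id.prodMk measurable_const))).aestronglyMeasurable
    · rw [norm_mul]
      calc ‖deriv g t‖ * ‖stepKernel t (z i)‖ ≤ K * 1 :=
            mul_le_mul (norm_deriv_le_of_lipschitz hg) (abs_stepKernel_le_one _ _)
              (norm_nonneg _) K.2
        _ = K := mul_one _
  have e : ∑ i, c i * g (z i) = ∫ t in Set.Ioc (-B) B, deriv g t * Q t := by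
    have : ∀ t, deriv g t * Q t = ∑ i, c i * (deriv g t * stepKernel t (z i)) := by
      intro t
      rw [hQ, Finset.mul_sum]
      exact Finset.sum_congr rfl fun i _ => by ring
    simp_rw [this]
    rw [integral_finsetSum _ fun i _ => (hdint i).const_mul _]
    refine Finset.sum_congr rfl fun i _ => ?_
    rw [integral_const_mul, integral_deriv_mul_stepKernel hg (hz i), hg0, sub_zero]
  have hdm : Measurable fun t => (Q t - h t) ^ 2 := (hQm.sub hm).pow_const 2
  have hsq : IntegrableOn (fun t => (Q t - h t) ^ 2) (Set.Ioc (-B) B) := by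
    refine ⟨hdm.aestronglyMeasurable, ?_⟩
    rw [hasFiniteIntegral_iff_ofReal (Filter.Eventually.of_forall fun t => sq_nonneg _)]
    exact hdev.trans_lt ENNReal.ofReal_lt_top
  have hsqT : ∫ t in Set.Ioc (-B) B, (Q t - h t) ^ 2 ≤ T := by
    rw [integral_eq_lintegral_of_nonneg_ae (Filter.Eventually.of_forall fun t => sq_nonneg _)
      hdm.aestronglyMeasurable]
    exact ENNReal.toReal_le_of_le_ofReal hT hdev
  have hconst : IntegrableOn (fun _ : ℝ => l / 2 + H) (Set.Ioc (-B) B) :=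
    integrableOn_const (by simp)
  rw [e]
  calc |∫ t in Set.Ioc (-B) B, deriv g t * Q t|
      ≤ ∫ t in Set.Ioc (-B) B, K * ((Q t - h t) ^ 2 * (1 / (2 * l)) + (l / 2 + H)) := by
        rw [← Real.norm_eq_abs]
        refine norm_integral_le_of_norm_le (((hsq.mul_const _).add hconst).const_mul _)
          (Filter.Eventually.of_forall fun t => ?_)
        rw [norm_mul]
        refine mul_le_mul (norm_deriv_le_of_lipschitz hg) ?_ (norm_nonneg _) K.2
        have h1 : |Q t| ≤ |Q t - h t| + H := by
          have := abs_add_le (Q t - h t) (h t)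
          rw [sub_add_cancel] at this
          linarith [hH t]
        -- AM–GM with free scale `l`. Integration over an interval of length `2 * B` turns it into
        -- `T / (2 * l) + l * B`.
        have h2 : |Q t - h t| ≤ (Q t - h t) ^ 2 * (1 / (2 * l)) + l / 2 := by
          rw [← sq_abs (Q t - h t), mul_one_div, div_add' _ _ _ (by positivity),
            le_div_iff₀ (by positivity)]
          nlinarith [sq_nonneg (|Q t - h t| - l)]
        rw [Real.norm_eq_abs]
        linarith
    _ = K * ((∫ t in Set.Ioc (-B) B, (Q t - h t) ^ 2) * (1 / (2 * l)) + 2 * B * (l / 2 + H)) := by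
        rw [integral_const_mul, integral_add (hsq.mul_const _) hconst, integral_mul_const,
          setIntegral_const]
        simp only [Measure.real, Real.volume_Ioc, smul_eq_mul]
        rw [ENNReal.toReal_ofReal (by linarith)]
        ring
    _ ≤ K * (T * (1 / (2 * l)) + 2 * B * (l / 2 + H)) := by
        have : 0 ≤ 1 / (2 * l) := by positivity
        have hK : (0 : ℝ) ≤ K := K.2
        gcongr
    _ = K * (T / (2 * l) + l * B) + 2 * K * B * H := by ring

end Duality

/-! ### Second-moment concentration for sample means -/

section Concentration

open ProbabilityTheory

variable {Ω : Type*} [MeasurableSpace Ω] (D : Measure Ω) [IsProbabilityMeasure D]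

theorem memLp_sampleMean (m : ℕ) {f : Ω → ℝ} (hf : MemLp f 2 D) :
    MemLp (fun S : Fin m → Ω => (1 / (m : ℝ)) * ∑ i, f (S i)) 2 (Measure.pi fun _ => D) := by
  refine MemLp.const_mul ?_ _
  exact memLp_finsetSum _ fun i _ => hf.comp_measurePreserving (measurePreserving_eval _ i)

theorem integral_sampleMean {m : ℕ} (hm : 0 < m) {f : Ω → ℝ} (hf : MemLp f 2 D) :
    ∫ S : Fin m → Ω, (1 / (m : ℝ)) * ∑ i, f (S i) ∂(Measure.pi fun _ => D) = ∫ x, f x ∂D := by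
  have h1 : ∀ i : Fin m, ∫ S : Fin m → Ω, f (S i) ∂(Measure.pi fun _ => D) = ∫ x, f x ∂D := by
    intro i
    have := (measurePreserving_eval (fun _ : Fin m => D) i)
    conv_rhs => rw [← this.map_eq]
    rw [integral_map this.measurable.aemeasurable (by rw [this.map_eq]; exact hf.1)]
  rw [integral_const_mul, integral_finsetSum]
  · simp_rw [h1]
    simp only [Finset.sum_const, Finset.card_univ, Fintype.card_fin, nsmul_eq_mul]
    have : (m : ℝ) ≠ 0 := by positivity
    field_simp
  · intro i _
    exact (hf.comp_measurePreserving (measurePreserving_eval _ i)).integrable (by norm_num)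

theorem variance_sampleMean_le {m : ℕ} (hm : 0 < m) {f : Ω → ℝ} (hf : MemLp f 2 D) :
    Var[fun S : Fin m → Ω => (1 / (m : ℝ)) * ∑ i, f (S i); Measure.pi fun _ => D]
      ≤ (∫ x, f x ^ 2 ∂D) / m := by
  have h := variance_sum_pi (μ := fun _ : Fin m => D) (X := fun _ => f) fun _ => hf
  have e : (∑ i : Fin m, fun ω : Fin m → Ω => f (ω i)) = fun ω => ∑ i, f (ω i) := by
    funext ω; simp
  rw [e] at h
  rw [variance_const_mul, h]
  have hv : Var[f; D] ≤ ∫ x, f x ^ 2 ∂D := variance_le_expectation_sq hf.1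
  simp only [Finset.sum_const, Finset.card_univ, Fintype.card_fin, nsmul_eq_mul]
  have hm' : (0 : ℝ) < m := by positivity
  rw [show (1 / (m : ℝ)) ^ 2 * (m * Var[f; D]) = Var[f; D] / m by field_simp]
  gcongr

theorem lintegral_sampleMean_sub_sq_le {m : ℕ} (hm : 0 < m) {f : Ω → ℝ} (hf : MemLp f 2 D) :
    ∫⁻ S : Fin m → Ω, ENNReal.ofReal (((1 / (m : ℝ)) * ∑ i, f (S i) - ∫ x, f x ∂D) ^ 2)
      ∂(Measure.pi fun _ => D) ≤ ENNReal.ofReal ((∫ x, f x ^ 2 ∂D) / m) := by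
  have h := ofReal_variance (memLp_sampleMean D m hf)
  rw [evariance_eq_lintegral_ofReal, integral_sampleMean D hm hf] at h
  rw [← h]
  exact ENNReal.ofReal_le_ofReal (variance_sampleMean_le D hm hf)

/-- Chebyshev's inequality for sample means. -/
theorem measure_sampleMean_deviation_le {m : ℕ} (hm : 0 < m) {f : Ω → ℝ} (hf : MemLp f 2 D)
    {s p : ℝ} (hs : 0 < s) (hp : ∫ x, f x ^ 2 ∂D ≤ m * s ^ 2 * p) :
    (Measure.pi fun _ : Fin m => D)
      {S | s ≤ |(1 / (m : ℝ)) * ∑ i, f (S i) - ∫ x, f x ∂D|} ≤ ENNReal.ofReal p := by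
  have h := meas_ge_le_variance_div_sq (memLp_sampleMean D m hf) hs
  rw [integral_sampleMean D hm hf] at h
  refine h.trans (ENNReal.ofReal_le_ofReal ?_)
  rw [div_le_iff₀ (by positivity)]
  refine (variance_sampleMean_le D hm hf).trans ?_
  rw [div_le_iff₀ (by positivity)]
  linarith

/-- Union bound over the sample. -/
theorem measure_exists_mem_le {m : ℕ} {A : Set Ω} (hA : MeasurableSet A) {p : ℝ}
    (hp : m * D.real A ≤ p) :
    (Measure.pi fun _ : Fin m => D) {S | ∃ i, S i ∈ A} ≤ ENNReal.ofReal p := by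
  have e : {S : Fin m → Ω | ∃ i, S i ∈ A} = ⋃ i, (fun S : Fin m → Ω => S i) ⁻¹' A := by
    ext S; simp
  rw [e]
  refine (measure_iUnion_fintype_le _ _).trans ?_
  have h1 : ∀ i : Fin m, (Measure.pi fun _ : Fin m => D) ((fun S : Fin m → Ω => S i) ⁻¹' A) = D A :=
    fun i => (measurePreserving_eval (fun _ : Fin m => D) i).measure_preimage
      hA.nullMeasurableSet
  simp_rw [h1]
  rw [Finset.sum_const, Finset.card_univ, Fintype.card_fin, nsmul_eq_mul,
    ← ENNReal.ofReal_natCast, ← ofReal_measureReal, ← ENNReal.ofReal_mul (by positivity)]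
  exact ENNReal.ofReal_le_ofReal hp

/-- Each of finitely many events of probability at least `p₀` has empirical frequency at least
`p₀ / 2`, except with probability at most `p`. -/
theorem measure_exists_freq_lt_le {m : ℕ} (hm : 0 < m) {κ : Type*} [Fintype κ] {A : κ → Set Ω}
    (hA : ∀ j, MeasurableSet (A j)) {p₀ p : ℝ} (hp₀ : 0 < p₀) (hAp : ∀ j, p₀ ≤ D.real (A j))
    (hp : 4 * Fintype.card κ ≤ m * p₀ * p) :
    (Measure.pi fun _ : Fin m => D)
      {S | ∃ j, (1 / (m : ℝ)) * ∑ i, (A j).indicator (fun _ => (1 : ℝ)) (S i) < p₀ / 2}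
      ≤ ENNReal.ofReal p := by
  have e : {S : Fin m → Ω | ∃ j, (1 / (m : ℝ)) * ∑ i, (A j).indicator (fun _ => (1 : ℝ)) (S i)
      < p₀ / 2} = ⋃ j, {S : Fin m → Ω | (1 / (m : ℝ)) *
        ∑ i, (A j).indicator (fun _ => (1 : ℝ)) (S i) < p₀ / 2} := by
    ext S; simp
  rw [e]
  refine (measure_iUnion_fintype_le _ _).trans ?_
  have h1 : ∀ j, (Measure.pi fun _ : Fin m => D) {S : Fin m → Ω | (1 / (m : ℝ)) *
        ∑ i, (A j).indicator (fun _ => (1 : ℝ)) (S i) < p₀ / 2}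
        ≤ ENNReal.ofReal (4 / (m * p₀)) := by
    intro j
    set q := D.real (A j) with hq
    have hpq := hAp j
    have hq0 : 0 < q := hp₀.trans_le hpq
    have hf : MemLp ((A j).indicator fun _ => (1 : ℝ)) 2 D := memLp_indicator_const 2 (hA j) 1
      (Or.inr (measure_ne_top _ _))
    have hint : ∫ x, (A j).indicator (fun _ => (1 : ℝ)) x ∂D = q := by
      rw [integral_indicator_const _ (hA j)]; simp [hq]
    have hsq : ∫ x, (A j).indicator (fun _ => (1 : ℝ)) x ^ 2 ∂D = q := by
      rw [← hint]
      congr 1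
      funext x
      by_cases hx : x ∈ A j <;> simp [hx]
    -- The deviation is measured relative to `q`: as the second moment is also `q`, Chebyshev gives
    -- `4 / (m * q)`, hence one power of `p₀` in the bound rather than two.
    refine le_trans (measure_mono ?_) (measure_sampleMean_deviation_le D hm hf (s := q / 2)
      (p := 4 / (m * p₀)) (by positivity) ?_)
    · intro S hS
      simp only [Set.mem_ofPred_eq] at hS ⊢
      rw [hint, abs_sub_comm]
      refine le_trans ?_ (le_abs_self _)
      linarith
    · rw [hsq]
      have hm' : (0 : ℝ) < m := by positivity
      rw [show (m : ℝ) * (q / 2) ^ 2 * (4 / (m * p₀)) = q * (q / p₀) by field_simp; ring]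
      exact le_mul_of_one_le_right hq0.le ((one_le_div hp₀).2 hpq)
  refine (Finset.sum_le_sum fun j _ => h1 j).trans ?_
  rw [Finset.sum_const, Finset.card_univ, nsmul_eq_mul, ← ENNReal.ofReal_natCast,
    ← ENNReal.ofReal_mul (by positivity)]
  refine ENNReal.ofReal_le_ofReal ?_
  have hm' : (0 : ℝ) < m := by positivity
  rw [mul_div_assoc', div_le_iff₀ (by positivity)]
  linarith

/-- Markov's inequality for the integrated squared deviation of a family of sample means. -/
theorem measure_integrated_deviation_le {m : ℕ} (hm : 0 < m) {F : ℝ → Ω → ℝ} {V B T p : ℝ}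
    (hF : Measurable fun q : ℝ × Ω => F q.1 q.2) (hFL : ∀ t, MemLp (F t) 2 D)
    (hV : ∀ t, ∫ x, F t x ^ 2 ∂D ≤ V) (hT : 0 < T) (hB : 0 ≤ B)
    (hp : 2 * B * V ≤ m * T * p) :
    (Measure.pi fun _ : Fin m => D)
      {S | ENNReal.ofReal T ≤ ∫⁻ t in Set.Ioc (-B) B, ENNReal.ofReal
        ((∑ i, (1 / (m : ℝ)) * F t (S i) - ∫ x, F t x ∂D) ^ 2)} ≤ ENNReal.ofReal p := by
  have hm' : (0 : ℝ) < m := by positivity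
  have hmean : Measurable fun t => ∫ x, F t x ∂D :=
    (StronglyMeasurable.integral_prod_right (f := fun t x => F t x)
      hF.stronglyMeasurable).measurable
  have hjoint : Measurable fun q : (Fin m → Ω) × ℝ => ENNReal.ofReal
        ((∑ i, (1 / (m : ℝ)) * F q.2 (q.1 i) - ∫ x, F q.2 x ∂D) ^ 2) := by
    refine ENNReal.measurable_ofReal.comp (((Finset.measurable_sum _ fun i _ =>
      Measurable.const_mul ?_ _).sub (hmean.comp measurable_snd)).pow_const 2)
    exact hF.comp (measurable_snd.prodMk ((measurable_pi_apply i).comp measurable_fst))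
  have hmeas := hjoint.lintegral_prod_right' (ν := volume.restrict (Set.Ioc (-B) B))
  refine (meas_ge_le_lintegral_div hmeas.aemeasurable (by simpa using hT)
    ENNReal.ofReal_ne_top).trans ?_
  -- By Tonelli, the expected integrated squared deviation is the integral over `t` of variances,
  -- each at most `V / m`.
  rw [lintegral_lintegral_swap hjoint.aemeasurable]
  have hbound : ∫⁻ t in Set.Ioc (-B) B, ∫⁻ S : Fin m → Ω, ENNReal.ofReal
        ((∑ i, (1 / (m : ℝ)) * F t (S i) - ∫ x, F t x ∂D) ^ 2) ∂(Measure.pi fun _ => D)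
        ≤ ENNReal.ofReal (2 * B * (V / m)) := by
    calc _ ≤ ∫⁻ t in Set.Ioc (-B) B, ENNReal.ofReal (V / m) := by
          refine lintegral_mono fun t => ?_
          simp_rw [← Finset.mul_sum]
          refine (lintegral_sampleMean_sub_sq_le D hm (hFL t)).trans (ENNReal.ofReal_le_ofReal ?_)
          have := hV t
          gcongr
      _ = _ := by
          rw [setLIntegral_const, Real.volume_Ioc, mul_comm, ← ENNReal.ofReal_mul (by linarith)]
          congr 1; ring
  refine (ENNReal.div_le_div_right hbound _).trans ?_
  rw [← ENNReal.ofReal_div_of_pos hT]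
  refine ENNReal.ofReal_le_ofReal ?_
  rw [div_le_iff₀ hT, mul_div_assoc', div_le_iff₀ hm']
  linarith

end Concentration

/-! ### Tails, moments and box masses of well-behaved marginals -/

section WellBehaved

variable {d : ℕ} {L R : ℝ} {P : Measure (EuclideanSpace ℝ (Fin d))}

theorem lintegral_exp_neg_mul_abs {c : ℝ} (hc : 0 < c) :
    ∫⁻ t : ℝ, ENNReal.ofReal (Real.exp (-c * |t|)) = ENNReal.ofReal (2 / c) := by
  have hval : ∫ t : ℝ, Real.exp (-c * |t|) = 2 / c := by
    rw [integral_comp_abs (f := fun t => Real.exp (-c * t)),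
      integral_exp_mul_Ioi (by linarith) 0]
    simp
    ring
  have hint : Integrable fun t : ℝ => Real.exp (-c * |t|) := by
    -- A non-integrable function would have integral `0`, contradicting the value just computed.
    by_contra h
    rw [integral_undef h] at hval
    have : 0 < 2 / c := by positivity
    linarith
  rw [← hval, ofReal_integral_eq_lintegral_ofReal hint
    (Filter.Eventually.of_forall fun t => (Real.exp_pos _).le)]

/-- Half of the exponential decay of the density pays for the exponential moment; the other half
integrates to `4 / L`, and the prefactor `1 / L` remains. -/
theorem lintegral_exp_inner_le (hL : 0 < L) (hP : IsWellBehaved L R P)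
    {v : EuclideanSpace ℝ (Fin d)} (hv : ‖v‖ = 1) :
    ∫⁻ x, ENNReal.ofReal (Real.exp (L / 2 * |⟪v, x⟫|)) ∂P ≤ ENNReal.ofReal (4 / L ^ 2) := by
  have hon : Orthonormal ℝ (fun _ : Fin 1 => v) :=
    ⟨fun _ => hv, fun i j hij => absurd (Subsingleton.elim i j) hij⟩
  obtain ⟨γ, hγm, hγ0, hmap, -, hup⟩ := hP 1 le_rfl (by norm_num) _ hon
  have hF : Measurable fun z : EuclideanSpace ℝ (Fin 1) =>
      ENNReal.ofReal (Real.exp (L / 2 * |z 0|)) := by fun_prop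
  have e1 : ∫⁻ x, ENNReal.ofReal (Real.exp (L / 2 * |⟪v, x⟫|)) ∂P
      = ∫⁻ z, ENNReal.ofReal (Real.exp (L / 2 * |z 0|))
        ∂(P.map fun x => WithLp.toLp 2 (fun _ : Fin 1 => ⟪v, x⟫)) := by
    rw [lintegral_map hF (by fun_prop)]
  rw [e1, hmap, lintegral_withDensity_eq_lintegral_mul _ (by fun_prop) hF]
  have hcoord : MeasurePreserving (fun z : EuclideanSpace ℝ (Fin 1) => z 0) := by
    have := (volume_preserving_funUnique (Fin 1) ℝ).comp (PiLp.volume_preserving_ofLp (Fin 1))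
    exact this
  calc ∫⁻ z : EuclideanSpace ℝ (Fin 1), ENNReal.ofReal (γ z) *
        ENNReal.ofReal (Real.exp (L / 2 * |z 0|))
      ≤ ∫⁻ z : EuclideanSpace ℝ (Fin 1),
          ENNReal.ofReal (1 / L) * ENNReal.ofReal (Real.exp (-(L / 2) * |z 0|)) := by
        refine lintegral_mono fun z => ?_
        rw [← ENNReal.ofReal_mul (hγ0 z), ← ENNReal.ofReal_mul (by positivity)]
        refine ENNReal.ofReal_le_ofReal ?_
        have hz : ‖z‖ = |z 0| := by simp [EuclideanSpace.norm_eq, Real.sqrt_sq_eq_abs]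
        have h := hup z
        rw [hz] at h
        calc γ z * Real.exp (L / 2 * |z 0|)
            ≤ 1 / L * Real.exp (-L * |z 0|) * Real.exp (L / 2 * |z 0|) := by gcongr
          _ = 1 / L * Real.exp (-(L / 2) * |z 0|) := by
            rw [mul_assoc, ← Real.exp_add]; ring_nf
    _ = ∫⁻ t : ℝ, ENNReal.ofReal (1 / L) * ENNReal.ofReal (Real.exp (-(L / 2) * |t|)) :=
        hcoord.lintegral_comp (f := fun t : ℝ =>
          ENNReal.ofReal (1 / L) * ENNReal.ofReal (Real.exp (-(L / 2) * |t|))) (by fun_prop)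
    _ = ENNReal.ofReal (4 / L ^ 2) := by
        rw [lintegral_const_mul _ (by fun_prop), lintegral_exp_neg_mul_abs (by positivity),
          ← ENNReal.ofReal_mul (by positivity)]
        congr 1
        field_simp
        norm_num

theorem integrable_exp_inner (hL : 0 < L) (hP : IsWellBehaved L R P)
    {v : EuclideanSpace ℝ (Fin d)} (hv : ‖v‖ = 1) :
    Integrable (fun x => Real.exp (L / 2 * |⟪v, x⟫|)) P := by
  refine ⟨by fun_prop, ?_⟩
  rw [hasFiniteIntegral_iff_ofReal (Filter.Eventually.of_forall fun t => (Real.exp_pos _).le)]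
  exact (lintegral_exp_inner_le hL hP hv).trans_lt ENNReal.ofReal_lt_top

theorem integral_exp_inner_le (hL : 0 < L) (hP : IsWellBehaved L R P)
    {v : EuclideanSpace ℝ (Fin d)} (hv : ‖v‖ = 1) :
    ∫ x, Real.exp (L / 2 * |⟪v, x⟫|) ∂P ≤ 4 / L ^ 2 := by
  rw [integral_eq_lintegral_of_nonneg_ae (Filter.Eventually.of_forall fun t => (Real.exp_pos _).le)
    (by fun_prop)]
  exact ENNReal.toReal_le_of_le_ofReal (by positivity) (lintegral_exp_inner_le hL hP hv)

theorem abs_inner_pow_le {v x : EuclideanSpace ℝ (Fin d)} (hL : 0 < L) (n : ℕ) :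
    |⟪v, x⟫| ^ n ≤ n.factorial * (2 / L) ^ n * Real.exp (L / 2 * |⟪v, x⟫|) := by
  have h := Real.pow_div_factorial_le_exp (L / 2 * |⟪v, x⟫|) (by positivity) n
  rw [div_le_iff₀ (by positivity)] at h
  calc |⟪v, x⟫| ^ n = (2 / L) ^ n * (L / 2 * |⟪v, x⟫|) ^ n := by
        rw [← mul_pow]; congr 1; field_simp
    _ ≤ (2 / L) ^ n * (Real.exp (L / 2 * |⟪v, x⟫|) * n.factorial) := by gcongr
    _ = _ := by ring

theorem integrable_inner_pow (hL : 0 < L) (hP : IsWellBehaved L R P) [IsProbabilityMeasure P]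
    (v : EuclideanSpace ℝ (Fin d)) (n : ℕ) : Integrable (fun x => ⟪v, x⟫ ^ n) P := by
  have key : ∀ v : EuclideanSpace ℝ (Fin d), ‖v‖ = 1 → Integrable (fun x => ⟪v, x⟫ ^ n) P := by
    intro v hv
    refine ((integrable_exp_inner hL hP hv).const_mul (n.factorial * (2 / L) ^ n)).mono'
      (by fun_prop) (Filter.Eventually.of_forall fun x => ?_)
    rw [norm_pow, Real.norm_eq_abs]
    exact abs_inner_pow_le hL n
  rcases eq_or_ne v 0 with rfl | hv
  · simp
  · have h := (key (‖v‖⁻¹ • v) (norm_smul_inv_norm hv)).const_mul (‖v‖ ^ n)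
    refine h.congr (Filter.Eventually.of_forall fun x => ?_)
    simp only [real_inner_smul_left, mul_pow]
    rw [← mul_assoc, ← mul_pow, mul_inv_cancel₀ (norm_ne_zero_iff.2 hv), one_pow, one_mul]

/-- The exponential moment alone would give order `L⁻⁶`. Interpolating between the second moment, at
most `1`, and the sixth, of order `L⁻⁸`, gives order `L⁻⁴`; the weights `215 / L ^ 4` and `L ^ 4 /
860` make the AM–GM inequality exact and balance the two terms. -/
theorem integral_inner_pow_four_le (hL : 0 < L) (hP : IsWellBehaved L R P)
    [IsProbabilityMeasure P] (hS : SecondMomentLeOne P) (v : EuclideanSpace ℝ (Fin d)) :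
    ∫ x, ⟪v, x⟫ ^ 4 ∂P ≤ 430 / L ^ 4 * ‖v‖ ^ 4 := by
  have key : ∀ v : EuclideanSpace ℝ (Fin d), ‖v‖ = 1 → ∫ x, ⟪v, x⟫ ^ 4 ∂P ≤ 430 / L ^ 4 := by
    intro v hv
    have h2 : ∫ x, ⟪v, x⟫ ^ 2 ∂P ≤ 1 := by simpa [hv] using hS v
    have h6 : ∫ x, ⟪v, x⟫ ^ 6 ∂P ≤ 184320 / L ^ 8 := by
      calc ∫ x, ⟪v, x⟫ ^ 6 ∂P
          ≤ ∫ x, 720 * (2 / L) ^ 6 * Real.exp (L / 2 * |⟪v, x⟫|) ∂P := by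
            refine integral_mono (integrable_inner_pow hL hP v 6)
              ((integrable_exp_inner hL hP hv).const_mul _) fun x => ?_
            have h := abs_inner_pow_le (v := v) (x := x) hL 6
            rw [Even.pow_abs (by decide)] at h
            simpa [Nat.factorial] using h
        _ ≤ 720 * (2 / L) ^ 6 * (4 / L ^ 2) := by
            rw [integral_const_mul]
            have := integral_exp_inner_le hL hP hv
            gcongr
        _ = 184320 / L ^ 8 := by field_simp; norm_num
    have hpt : ∀ x, ⟪v, x⟫ ^ 4 ≤ 215 / L ^ 4 * ⟪v, x⟫ ^ 2 + L ^ 4 / 860 * ⟪v, x⟫ ^ 6 := by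
      intro x
      have : 0 ≤ ⟪v, x⟫ ^ 2 * (215 / L ^ 4) * (1 - L ^ 4 / 430 * ⟪v, x⟫ ^ 2) ^ 2 := by positivity
      have e : ⟪v, x⟫ ^ 2 * (215 / L ^ 4) * (1 - L ^ 4 / 430 * ⟪v, x⟫ ^ 2) ^ 2
          = 215 / L ^ 4 * ⟪v, x⟫ ^ 2 + L ^ 4 / 860 * ⟪v, x⟫ ^ 6 - ⟪v, x⟫ ^ 4 := by
        field_simp; ring
      linarith
    have hi2 := (integrable_inner_pow hL hP v 2).const_mul (215 / L ^ 4)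
    have hi6 := (integrable_inner_pow hL hP v 6).const_mul (L ^ 4 / 860)
    calc ∫ x, ⟪v, x⟫ ^ 4 ∂P
        ≤ ∫ x, (215 / L ^ 4 * ⟪v, x⟫ ^ 2 + L ^ 4 / 860 * ⟪v, x⟫ ^ 6) ∂P :=
          integral_mono (integrable_inner_pow hL hP v 4) (hi2.add hi6) hpt
      _ = 215 / L ^ 4 * ∫ x, ⟪v, x⟫ ^ 2 ∂P + L ^ 4 / 860 * ∫ x, ⟪v, x⟫ ^ 6 ∂P := by
          rw [integral_add hi2 hi6, integral_const_mul, integral_const_mul]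
      _ ≤ 215 / L ^ 4 * 1 + L ^ 4 / 860 * (184320 / L ^ 8) := by gcongr
      _ = (215 + 184320 / 860) / L ^ 4 := by field_simp
      _ ≤ 430 / L ^ 4 := by gcongr; norm_num
  rcases eq_or_ne v 0 with rfl | hv
  · simp
  · have hv' := norm_ne_zero_iff.2 hv
    have h := key (‖v‖⁻¹ • v) (norm_smul_inv_norm hv)
    simp only [real_inner_smul_left, mul_pow, integral_const_mul] at h
    rw [inv_pow, inv_mul_le_iff₀ (by positivity)] at h
    linarith

theorem measureReal_inner_gt_le (hL : 0 < L) (hP : IsWellBehaved L R P)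
    [IsProbabilityMeasure P] (v : EuclideanSpace ℝ (Fin d)) {r s : ℝ}
    (hr : ‖v‖ * s ≤ r) :
    P.real {x | r < |⟪v, x⟫|} ≤ 4 / L ^ 2 * Real.exp (-(L / 2 * s)) := by
  rcases eq_or_ne v 0 with rfl | hv
  · have : {x : EuclideanSpace ℝ (Fin d) | r < |⟪(0 : EuclideanSpace ℝ (Fin d)), x⟫|} = ∅ := by
      ext x
      simp only [norm_zero, zero_mul] at hr
      simpa using hr
    rw [this, measureReal_empty]
    positivity
  · have hv' := norm_ne_zero_iff.2 hv
    have hu := norm_smul_inv_norm (𝕜 := ℝ) hv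
    have h := mul_meas_ge_le_integral_of_nonneg
      (Filter.Eventually.of_forall fun x => (Real.exp_pos _).le)
      (integrable_exp_inner hL hP hu) (Real.exp (L / 2 * s))
    have h2 := h.trans (integral_exp_inner_le hL hP hu)
    rw [Real.exp_neg, ← div_eq_mul_inv, le_div_iff₀ (Real.exp_pos _), mul_comm]
    refine le_trans (mul_le_mul_of_nonneg_left (measureReal_mono ?_) (Real.exp_pos _).le) h2
    intro x hx
    simp only [Set.mem_ofPred_eq] at hx ⊢
    refine Real.exp_le_exp.2 (mul_le_mul_of_nonneg_left ?_ (by positivity))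
    rw [RCLike.ofReal_real_eq_id, id, real_inner_smul_left, abs_mul, abs_of_nonneg (by positivity),
      le_inv_mul_iff₀ (by positivity)]
    linarith

/-- Lower bound for the mass of boxes inside the region where the density is at least `L`. -/
theorem le_measureReal_box (hL : 0 < L) (hP : IsWellBehaved L R P) [IsProbabilityMeasure P]
    {k : ℕ} (hk1 : 1 ≤ k) (hk2 : k ≤ 2) {e : Fin k → EuclideanSpace ℝ (Fin d)}
    (he : Orthonormal ℝ e) {lo hi : Fin k → ℝ} (hlo : ∀ i, 0 ≤ lo i) (hlh : ∀ i, lo i ≤ hi i)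
    (hhi : ∀ i, hi i ≤ R) :
    L * ∏ i, (hi i - lo i) ≤ P.real {x | ∀ i, ⟪e i, x⟫ ∈ Set.Ico (lo i) (hi i)} := by
  obtain ⟨γ, hγm, hγ0, hmap, hlow, -⟩ := hP k hk1 hk2 _ he
  set A : Set (Fin k → ℝ) := Set.pi Set.univ fun i => Set.Ico (lo i) (hi i) with hA
  have hAm : MeasurableSet A := MeasurableSet.univ_pi fun i => measurableSet_Ico
  have hpre : MeasurableSet ((WithLp.ofLp : EuclideanSpace ℝ (Fin k) → Fin k → ℝ) ⁻¹' A) :=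
    (PiLp.volume_preserving_ofLp (Fin k)).measurable hAm
  have e1 : P {x | ∀ i, ⟪e i, x⟫ ∈ Set.Ico (lo i) (hi i)}
      = (P.map fun x => WithLp.toLp 2 (fun i => ⟪e i, x⟫)) (WithLp.ofLp ⁻¹' A) := by
    rw [Measure.map_apply (by fun_prop) hpre]
    congr 1
    ext x
    simp [hA]
  have hvol : volume ((WithLp.ofLp : EuclideanSpace ℝ (Fin k) → Fin k → ℝ) ⁻¹' A)
      = ENNReal.ofReal (∏ i, (hi i - lo i)) := by
    rw [(PiLp.volume_preserving_ofLp (Fin k)).measure_preimage hAm.nullMeasurableSet, hA,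
      Real.volume_pi_Ico, ENNReal.ofReal_prod_of_nonneg fun i _ => sub_nonneg.2 (hlh i)]
  have h : ENNReal.ofReal (L * ∏ i, (hi i - lo i))
      ≤ P {x | ∀ i, ⟪e i, x⟫ ∈ Set.Ico (lo i) (hi i)} := by
    rw [e1, hmap, withDensity_apply _ hpre, ENNReal.ofReal_mul hL.le, ← hvol, ← setLIntegral_const]
    refine setLIntegral_mono (by fun_prop) fun z hz => ENNReal.ofReal_le_ofReal (hlow z fun i => ?_)
    have := hz i (Set.mem_univ i)
    rw [abs_of_nonneg ((hlo i).trans this.1)]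
    exact this.2.le.trans (hhi i)
  exact (ENNReal.ofReal_le_iff_le_toReal (measure_ne_top _ _)).1 h

end WellBehaved

/-! ### Misalignment forces squared error, uniformly over activations -/

section ErrorBound

variable {a b : ℝ}

/-- On a narrow cell, any activation errs by a constant amount either on the low or on the high
part of the orthogonal direction. -/
theorem cell_error_dichotomy {u f : ℝ → ℝ} (hb : 0 ≤ b) (ha : 0 < a) (hu : u ∈ activations a b)
    (hf : f ∈ activations a b) {r α β x₀ h R W : ℝ} (hr : |r| ≤ W) (hα : 0 ≤ α) (hαW : α ≤ W)
    (hβ : 0 < β) (hx₀ : 0 ≤ x₀) (hR : 0 < R) (hh : b * W * h ≤ a * β * R / 48) :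
    (∀ x₁ ∈ Set.Ico x₀ (x₀ + h), ∀ x₂ ∈ Set.Ico 0 (R / 3),
      (a * β * R / 8) ^ 2 ≤ (u (r * x₁) - f (α * x₁ + β * x₂)) ^ 2) ∨
    (∀ x₁ ∈ Set.Ico x₀ (x₀ + h), ∀ x₂ ∈ Set.Ico (2 * R / 3) R,
      (a * β * R / 8) ^ 2 ≤ (u (r * x₁) - f (α * x₁ + β * x₂)) ^ 2) := by
  have hW : 0 ≤ W := (abs_nonneg _).trans hr
  have hc : 0 < a * β * R := by positivity
  have hosc : ∀ x₁ ∈ Set.Ico x₀ (x₀ + h), |u (r * x₁) - u (r * x₀)| ≤ a * β * R / 48 := by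
    intro x hx
    refine (hu.2.2.1 _ _).trans (le_trans ?_ hh)
    rw [← mul_sub, abs_mul, abs_of_nonneg (sub_nonneg.2 hx.1), mul_assoc]
    have : x - x₀ ≤ h := by linarith [hx.2]
    have h0 : 0 ≤ x - x₀ := sub_nonneg.2 hx.1
    gcongr
  set A := f (α * x₀ + β * (R / 3)) with hA
  set B := f (α * x₀ + β * (2 * R / 3)) with hB
  have hAB : a * β * R / 3 ≤ B - A := by
    have h1 := hf.2.2.2 (α * x₀ + β * (2 * R / 3)) (α * x₀ + β * (R / 3)) (by positivity)
      (by nlinarith)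
    calc a * β * R / 3 = a * (α * x₀ + β * (2 * R / 3) - (α * x₀ + β * (R / 3))) := by ring
      _ ≤ _ := h1
  -- Half of the gap `B - A` is at least `a * β * R / 6`. At most two oscillations of `a * β * R /
  -- 48` are lost, leaving `a * β * R / 8`.
  rcases le_or_gt ((A + B) / 2) (u (r * x₀)) with hcase | hcase
  · left
    intro x₁ hx₁ x₂ hx₂
    have h1 := abs_le.1 (hosc x₁ hx₁)
    have h2 : f (α * x₁ + β * x₂) ≤ A + a * β * R / 48 := by
      have h3 : f (α * x₁ + β * x₂) ≤ f (α * x₁ + β * (R / 3)) := hf.2.1 (by nlinarith [hx₂.2])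
      have h4 := (le_abs_self _).trans
        (hf.2.2.1 (α * x₁ + β * (R / 3)) (α * x₀ + β * (R / 3)))
      have h5 : |α * x₁ + β * (R / 3) - (α * x₀ + β * (R / 3))| ≤ W * h := by
        rw [show α * x₁ + β * (R / 3) - (α * x₀ + β * (R / 3)) = α * (x₁ - x₀) by ring, abs_mul,
          abs_of_nonneg hα, abs_of_nonneg (sub_nonneg.2 hx₁.1)]
        have : x₁ - x₀ ≤ h := by linarith [hx₁.2]
        have h0 : 0 ≤ x₁ - x₀ := sub_nonneg.2 hx₁.1
        gcongr
      have h6 := mul_le_mul_of_nonneg_left h5 hb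
      linarith
    have h7 : a * β * R / 8 ≤ u (r * x₁) - f (α * x₁ + β * x₂) := by linarith
    exact pow_le_pow_left₀ (by positivity) h7 2
  · right
    intro x₁ hx₁ x₂ hx₂
    have h1 := abs_le.1 (hosc x₁ hx₁)
    have h2 : B ≤ f (α * x₁ + β * x₂) := hf.2.1 (by
      have := mul_le_mul_of_nonneg_left hx₁.1 hα
      have := mul_le_mul_of_nonneg_left hx₂.1 hβ.le
      linarith)
    have h7 : a * β * R / 8 ≤ f (α * x₁ + β * x₂) - u (r * x₁) := by linarith
    rw [← neg_sq (u _ - _), neg_sub]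
    exact pow_le_pow_left₀ (by positivity) h7 2

theorem card_mul_le_sampleMean {E κ : Type*} [Fintype κ] {A : κ → Set E}
    (hA : Pairwise fun i j => Disjoint (A i) (A j)) {F : E → ℝ} (hF : ∀ x, 0 ≤ F x) {c q : ℝ}
    (hc : 0 ≤ c) (hFA : ∀ j, ∀ x ∈ A j, c ≤ F x) {m : ℕ} {S : Fin m → E}
    (hq : ∀ j, q ≤ (1 / (m : ℝ)) * ∑ i, (A j).indicator (fun _ => (1 : ℝ)) (S i)) :
    Fintype.card κ * (q * c) ≤ (1 / (m : ℝ)) * ∑ i, F (S i) := by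
  classical
  have hpt : ∀ x, ∑ j, (A j).indicator (fun _ => (1 : ℝ)) x * c ≤ F x := by
    intro x
    by_cases hx : ∃ j, x ∈ A j
    · obtain ⟨j, hj⟩ := hx
      rw [Finset.sum_eq_single j]
      · simpa [hj] using hFA j x hj
      · intro k _ hk
        have : x ∉ A k := fun hxk => Set.disjoint_left.1 (hA hk) hxk hj
        simp [this]
      · simp
    · push Not at hx
      simpa [hx] using hF x
  calc Fintype.card κ * (q * c) = ∑ _j : κ, q * c := by
        rw [Finset.sum_const, Finset.card_univ, nsmul_eq_mul]
    _ ≤ ∑ j, (1 / (m : ℝ)) * (∑ i, (A j).indicator (fun _ => (1 : ℝ)) (S i)) * c :=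
        Finset.sum_le_sum fun j _ => mul_le_mul_of_nonneg_right (hq j) hc
    _ = (1 / (m : ℝ)) * ∑ i, ∑ j, (A j).indicator (fun _ => (1 : ℝ)) (S i) * c := by
        rw [Finset.sum_comm, Finset.mul_sum]
        exact Finset.sum_congr rfl fun j _ => by rw [mul_assoc, Finset.sum_mul]
    _ ≤ _ := by
        refine mul_le_mul_of_nonneg_left (Finset.sum_le_sum fun i _ => hpt _) (by positivity)

variable {d : ℕ}

theorem inner_perp_self (v w : EuclideanSpace ℝ (Fin d)) (hw : w ≠ 0) : ⟪w, perp v w⟫ = 0 := by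
  have : ‖w‖ ^ 2 ≠ 0 := pow_ne_zero 2 (norm_ne_zero_iff.2 hw)
  rw [perp, inner_sub_right, inner_smul_right, real_inner_self_eq_norm_sq, real_inner_comm]
  field_simp
  ring

theorem norm_perp_le (v w : EuclideanSpace ℝ (Fin d)) : ‖perp v w‖ ≤ ‖v‖ := by
  rcases eq_or_ne w 0 with rfl | hw
  · simp [perp]
  · have h0 := inner_perp_self v w hw
    have e : v = perp v w + (⟪v, w⟫ / ‖w‖ ^ 2) • w := by simp [perp]
    have h1 : ‖v‖ * ‖v‖ = ‖perp v w‖ * ‖perp v w‖ + ‖(⟪v, w⟫ / ‖w‖ ^ 2) • w‖ *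
        ‖(⟪v, w⟫ / ‖w‖ ^ 2) • w‖ := by
      conv_lhs => rw [e]
      refine norm_add_sq_eq_norm_sq_add_norm_sq_real ?_
      have h0' : ⟪perp v w, w⟫ = 0 := by rw [real_inner_comm]; exact h0
      rw [inner_smul_right, h0', mul_zero]
    nlinarith [norm_nonneg v, norm_nonneg (perp v w), norm_nonneg ((⟪v, w⟫ / ‖w‖ ^ 2) • w)]

/-- Coordinates adapted to the pair `(w, v)`, with `v` in the upper right quadrant. -/
theorem exists_adapted_frame (w v : EuclideanSpace ℝ (Fin d)) (hw : w ≠ 0)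
    (hβ : 0 < ‖perp v w‖) :
    ∃ e : Fin 2 → EuclideanSpace ℝ (Fin d), Orthonormal ℝ e ∧ ∃ r α : ℝ, |r| ≤ ‖w‖ ∧ 0 ≤ α ∧
      α ≤ ‖v‖ ∧ (∀ x, ⟪w, x⟫ = r * ⟪e 0, x⟫) ∧
      ∀ x, ⟪v, x⟫ = α * ⟪e 0, x⟫ + ‖perp v w‖ * ⟪e 1, x⟫ := by
  have hw' : ‖w‖ ≠ 0 := norm_ne_zero_iff.2 hw
  have hwp : 0 < ‖w‖ := norm_pos_iff.2 hw
  -- The sign orients the first axis so that `α ≥ 0`. Then `v · x ≥ 0` on the positive quadrant,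
  -- where `f` has slope at least `a`.
  obtain ⟨s, hs1, hs2⟩ : ∃ s : ℝ, s * s = 1 ∧ s * ⟪v, w⟫ = |⟪v, w⟫| := by
    rcases le_total 0 ⟪v, w⟫ with h | h
    · exact ⟨1, by norm_num, by rw [abs_of_nonneg h, one_mul]⟩
    · exact ⟨-1, by norm_num, by rw [abs_of_nonpos h, neg_one_mul]⟩
  have hs : |s| = 1 := by
    rw [← abs_one, ← sq_eq_sq_iff_abs_eq_abs]; nlinarith
  have hperp := inner_perp_self v w hw
  refine ⟨![(s / ‖w‖) • w, (1 / ‖perp v w‖) • perp v w], ?_, s * ‖w‖, |⟪v, w⟫| / ‖w‖, ?_,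
    by positivity, ?_, ?_, ?_⟩
  · rw [orthonormal_iff_ite]
    intro i j
    fin_cases i <;> fin_cases j
    · simp [norm_smul, hs, hw']
    · simp [real_inner_smul_left, real_inner_smul_right, hperp]
    · simp [real_inner_smul_right, real_inner_comm, hperp]
    · simp [norm_smul, hβ.ne']
  · rw [abs_mul, hs, one_mul, abs_of_pos hwp]
  · rw [div_le_iff₀ hwp]
    exact abs_real_inner_le_norm v w
  · intro x
    simp only [Matrix.cons_val_zero, real_inner_smul_left]
    field_simp
    rw [pow_two, hs1, mul_one]
  · intro x
    simp only [Matrix.cons_val_zero, Matrix.cons_val_one, Matrix.cons_val_fin_one,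
      real_inner_smul_left]
    rw [← hs2, perp, inner_sub_left, real_inner_smul_left]
    rw [perp] at hβ
    have := hβ.ne'
    field_simp
    rw [pow_two s, hs1]
    ring

/-- The empirical error bound: finitely many cells, such that whenever each of them has empirical
frequency at least half its guaranteed mass, every activation of `w · x` misses `f (v · x)` by an
amount quadratic in the misalignment of `v` and `w`. -/
theorem exists_error_cells {L R W : ℝ} {P : Measure (EuclideanSpace ℝ (Fin d))}
    [IsProbabilityMeasure P] (hP : IsWellBehaved L R P) (hL : 0 < L) (hR : 0 < R) (hR1 : R ≤ 1)
    (ha : 0 < a) (hab : a ≤ b) {w v : EuclideanSpace ℝ (Fin d)} (hw : ‖w‖ ≤ W) (hv : ‖v‖ ≤ W)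
    (hβ : 0 < ‖perp v w‖) {f : ℝ → ℝ} (hf : f ∈ activations a b) :
    ∃ (κ : Type) (_ : Fintype κ) (A : κ → Set (EuclideanSpace ℝ (Fin d))) (p₀ : ℝ),
      (∀ j, MeasurableSet (A j)) ∧ 0 < p₀ ∧ (∀ j, p₀ ≤ P.real (A j)) ∧
      Fintype.card κ * (a * ‖perp v w‖) ^ 2 * (L * R ^ 2) ≤ p₀ * (60000 * (b * W) ^ 2) ∧
      ∀ (m : ℕ) (S : Fin m → EuclideanSpace ℝ (Fin d)),
        (∀ j, p₀ / 2 ≤ (1 / (m : ℝ)) * ∑ i, (A j).indicator (fun _ => (1 : ℝ)) (S i)) →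
        ∀ u ∈ activations a b, a ^ 2 * L * R ^ 4 * ‖perp v w‖ ^ 2 / 384
          ≤ (1 / (m : ℝ)) * ∑ i, (u ⟪w, S i⟫ - f ⟪v, S i⟫) ^ 2 := by
  set β := ‖perp v w‖ with hβdef
  have hb : 0 < b := ha.trans_le hab
  have hβW : β ≤ W := (norm_perp_le v w).trans hv
  have hWpos : 0 < W := hβ.trans_le hβW
  have habW : a * β ≤ b * W := by gcongr
  rcases eq_or_ne w 0 with rfl | hw0
  -- For `w = 0` every activation predicts `0`, so one slab in the direction of `v` suffices.
  · have hpv : perp v 0 = v := by simp [perp]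
    rw [hpv] at hβdef
    have hvn : v ≠ 0 := by rw [← norm_pos_iff, ← hβdef]; exact hβ
    set e : Fin 1 → EuclideanSpace ℝ (Fin d) := fun _ => (1 / β) • v with he
    have heo : Orthonormal ℝ e := ⟨fun _ => by simp [he, norm_smul, hβdef, hvn],
      fun i j hij => absurd (Subsingleton.elim i j) hij⟩
    have hbox := le_measureReal_box hL hP le_rfl (by norm_num) heo (lo := fun _ => 2 * R / 3)
      (hi := fun _ => R) (fun _ => by positivity) (fun _ => by linarith) fun _ => le_rfl
    refine ⟨Unit, inferInstance, fun _ => {x | ∀ i, ⟪e i, x⟫ ∈ Set.Ico (2 * R / 3) R},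
      L * R / 3, fun _ => ?_, by positivity, fun _ => ?_, ?_, ?_⟩
    · have : {x | ∀ i, ⟪e i, x⟫ ∈ Set.Ico (2 * R / 3) R}
          = ⋂ i, (fun x => ⟪e i, x⟫) ⁻¹' Set.Ico (2 * R / 3) R := by ext x; simp
      rw [this]
      exact MeasurableSet.iInter fun i => measurableSet_Ico.preimage (by fun_prop)
    · simp only [Finset.univ_unique, Finset.prod_const, Finset.card_singleton, pow_one] at hbox
      linarith
    · simp only [Fintype.card_unit, Nat.cast_one, one_mul]
      have h1 : (a * β) ^ 2 ≤ (b * W) ^ 2 := by gcongr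
      have h2 : L * R ^ 2 ≤ L * R := by gcongr; nlinarith
      calc (a * β) ^ 2 * (L * R ^ 2) ≤ (b * W) ^ 2 * (L * R) := by gcongr
        _ ≤ L * R / 3 * (60000 * (b * W) ^ 2) := by nlinarith [show 0 < L * R * (b * W) ^ 2 by positivity]
    · intro m S hfreq u hu
      have h := card_mul_le_sampleMean (A := fun _ : Unit =>
        {x | ∀ i, ⟪e i, x⟫ ∈ Set.Ico (2 * R / 3) R}) (fun i j hij => absurd rfl hij)
        (F := fun x => (u ⟪(0 : EuclideanSpace ℝ (Fin d)), x⟫ - f ⟪v, x⟫) ^ 2)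
        (fun x => sq_nonneg _) (c := (a * β * R * (2 / 3)) ^ 2) (by positivity) ?_ hfreq
      · refine le_trans ?_ h
        have : R ^ 4 ≤ R ^ 3 := pow_le_pow_of_le_one hR.le hR1 (by norm_num)
        simp only [Fintype.card_unit, Nat.cast_one, one_mul]
        have h3 : a ^ 2 * L * R ^ 4 * β ^ 2 ≤ a ^ 2 * L * R ^ 3 * β ^ 2 := by gcongr
        have h4 : 0 < a ^ 2 * L * R ^ 4 * β ^ 2 := by positivity
        nlinarith
      · intro _ x hx
        have hx0 := (hx 0).1
        rw [he] at hx0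
        simp only [real_inner_smul_left, one_div, le_inv_mul_iff₀ hβ] at hx0
        have hpos : 0 ≤ ⟪v, x⟫ := le_trans (by positivity) hx0
        have h1 := hf.2.2.2 ⟪v, x⟫ 0 le_rfl hpos
        rw [hf.1, sub_zero, sub_zero] at h1
        simp only [inner_zero_left, hu.1, zero_sub, neg_sq]
        refine pow_le_pow_left₀ (by positivity) ?_ 2
        nlinarith
  · obtain ⟨e, heo, r, α, hr, hα, hαv, hew, hev⟩ := exists_adapted_frame w v hw0 hβ
    set t := b * W / (a * β) with ht
    -- With `N ≥ 48 * t` strips of width `R / N`, each activation varies by at most `a * β * R / 48`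
    -- on a strip.
    have ht1 : 1 ≤ t := (one_le_div (by positivity)).2 habW
    set N := ⌈48 * t⌉₊ with hN
    have hNl : 48 * t ≤ N := Nat.le_ceil _
    have hNu : (N : ℝ) ≤ 49 * t := by
      have := Nat.ceil_lt_add_one (show 0 ≤ 48 * t by positivity)
      linarith
    have hN0 : (0 : ℝ) < N := by linarith
    set h := R / N with hh
    have hh0 : 0 < h := by positivity
    set lo : Fin N × Bool → Fin 2 → ℝ := fun j => ![j.1 * h, if j.2 then 2 * R / 3 else 0] with hlo
    set hi : Fin N × Bool → Fin 2 → ℝ := fun j => ![j.1 * h + h, if j.2 then R else R / 3] with hhi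
    set A : Fin N × Bool → Set (EuclideanSpace ℝ (Fin d)) :=
      fun j => {x | ∀ i, ⟪e i, x⟫ ∈ Set.Ico (lo j i) (hi j i)} with hA
    have hcell : b * W * h ≤ a * β * R / 48 := by
      rw [hh, mul_div_assoc', div_le_iff₀ hN0]
      have h1 : b * W * 48 ≤ N * (a * β) := by
        rw [ht, mul_div_assoc', div_le_iff₀ (by positivity)] at hNl
        linarith
      nlinarith
    refine ⟨Fin N × Bool, inferInstance, A, L * (h * (R / 3)), fun j => ?_, by positivity,
      fun j => ?_, ?_, ?_⟩
    · have : A j = ⋂ i, (fun x => ⟪e i, x⟫) ⁻¹' Set.Ico (lo j i) (hi j i) := by ext x; simp [hA]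
      rw [this]
      exact MeasurableSet.iInter fun i => measurableSet_Ico.preimage (by fun_prop)
    · have hj : ((j.1 : ℕ) : ℝ) + 1 ≤ N := by exact_mod_cast j.1.2
      have hjR : (j.1 : ℕ) * h + h ≤ R := by
        calc (j.1 : ℕ) * h + h = ((j.1 : ℕ) + 1) * h := by ring
          _ ≤ N * h := by gcongr
          _ = R := by rw [hh]; field_simp
      have hbox := le_measureReal_box hL hP (by norm_num) le_rfl heo (lo := lo j) (hi := hi j)
        ?_ ?_ ?_
      · refine le_trans (le_of_eq ?_) hbox
        rw [Fin.prod_univ_two]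
        rcases j with ⟨j, s⟩
        have : R - 2 * R / 3 = R / 3 := by ring
        cases s <;> simp [hlo, hhi, this]
      · intro i
        rcases j with ⟨j, s⟩
        fin_cases i <;> cases s <;> simp [hlo] <;> positivity
      · intro i
        rcases j with ⟨j, s⟩
        fin_cases i <;> cases s <;> simp [hlo, hhi] <;> linarith
      · intro i
        rcases j with ⟨j, s⟩
        fin_cases i <;> cases s <;> simp [hhi] <;> linarith
    · simp only [Fintype.card_prod, Fintype.card_fin, Fintype.card_bool, Nat.cast_mul,
        Nat.cast_ofNat]
      have e1 : b * W = t * (a * β) := by rw [ht]; field_simp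
      rw [e1, hh, show L * (R / N * (R / 3)) * (60000 * (t * (a * β)) ^ 2)
        = L * R ^ 2 * (20000 * (t * (a * β)) ^ 2) / N by field_simp; norm_num, le_div_iff₀ hN0]
      have h1 : (N : ℝ) ^ 2 ≤ (49 * t) ^ 2 := by gcongr
      have h2 : 0 < (a * β) ^ 2 * (L * R ^ 2) := by positivity
      nlinarith [mul_le_mul_of_nonneg_right h1 h2.le, mul_pos h2 (show 0 < t ^ 2 by positivity)]
    · intro m S hfreq u hu
      have hdich := fun j : Fin N => cell_error_dichotomy hb.le ha hu hf (r := r) (α := α)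
        (x₀ := j * h) (h := h) (hr.trans hw) hα (hαv.trans hv) hβ (by positivity) hR hcell
      -- Which of the two cells of a strip is bad depends on `u`. Controlling the frequencies of all
      -- `2 * N` cells beforehand covers every choice.
      have hsel : ∀ j : Fin N, ∃ s : Bool, ∀ x ∈ A (j, s),
          (a * β * R / 8) ^ 2 ≤ (u ⟪w, x⟫ - f ⟪v, x⟫) ^ 2 := by
        intro j
        rcases hdich j with hd | hd
        · refine ⟨false, fun x hx => ?_⟩
          rw [hew, hev]
          refine hd _ (by simpa [hlo, hhi] using hx 0) _ (by simpa [hlo, hhi] using hx 1)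
        · refine ⟨true, fun x hx => ?_⟩
          rw [hew, hev]
          refine hd _ (by simpa [hlo, hhi] using hx 0) _ (by simpa [hlo, hhi] using hx 1)
      choose s hs using hsel
      have hdisj : Pairwise fun i j : Fin N => Disjoint (A (i, s i)) (A (j, s j)) := by
        have key : ∀ i j : Fin N, i < j → Disjoint (A (i, s i)) (A (j, s j)) := by
          intro i j hij
          rw [Set.disjoint_left]
          intro x hx hx'
          have h1 : ⟪e 0, x⟫ < i * h + h := by simpa [hhi] using (hx 0).2
          have h2 : j * h ≤ ⟪e 0, x⟫ := by simpa [hlo] using (hx' 0).1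
          have h3 : ((i : ℕ) : ℝ) + 1 ≤ (j : ℕ) := by exact_mod_cast hij
          nlinarith
        intro i j hij
        rcases lt_or_gt_of_ne hij with h1 | h1
        · exact key i j h1
        · exact (key j i h1).symm
      have hfin := card_mul_le_sampleMean hdisj (F := fun x => (u ⟪w, x⟫ - f ⟪v, x⟫) ^ 2)
        (fun x => sq_nonneg _) (by positivity) hs fun j => hfreq (j, s j)
      refine le_trans (le_of_eq ?_) hfin
      -- The number of strips cancels: `N * (L * (R / N) * (R / 3) / 2) * (a * β * R / 8) ^ 2` has
      -- constant `1 / (6 * 64) = 1 / 384`.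
      rw [Fintype.card_fin, hh]
      field_simp
      norm_num

end ErrorBound

/-! ### Consequences of the sample-size hypothesis -/

section SampleSize

set_option maxHeartbeats 1000000 in
theorem sampleSize_bounds {d m : ℕ} {L b W ε δ : ℝ} (hd : 1 ≤ d) (hL : 0 < L) (hL1 : L ≤ 1)
    (hb : 1 ≤ b) (hε : 0 < ε) (hε1 : ε ≤ 1) (hδ : 0 < δ) (hδ1 : δ ≤ 1 / 2)
    (hm : (10 : ℝ) ^ 24 * (d * max 1 W ^ (9 / 2 : ℝ) * b ^ 4 / L ^ 4 * Real.log (d / (ε * δ)) ^ 4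
              * (1 / ε ^ (3 / 2 : ℝ) + 1 / (ε * δ))) ≤ (m : ℝ)) :
    0 < m ∧ 10 ^ 9 ≤ m * δ * L ^ 4 ∧ 1 ≤ Real.log (40 * m / (δ * L ^ 2)) ∧
      10 ^ 9 * (b * max 1 W * Real.log (40 * m / (δ * L ^ 2))) ^ 2 ≤ m * ε * δ * L ^ 2 := by
  set V := max 1 W with hV
  have hV1 : 1 ≤ V := le_max_left _ _
  have hd1 : (1 : ℝ) ≤ d := by exact_mod_cast hd
  have hεδ : ε * δ ≤ 1 / 2 := by nlinarith
  have hεδ0 : 0 < ε * δ := by positivity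
  set Λ := Real.log (d / (ε * δ)) with hΛ
  have hΛ1 : 0.69 ≤ Λ := by
    have h2 : (2 : ℝ) ≤ d / (ε * δ) := by
      rw [le_div_iff₀ hεδ0]; linarith
    have := Real.log_le_log (by norm_num) h2
    have := Real.log_two_gt_d9
    linarith
  have hΛ2 : Real.log (1 / (ε * δ)) ≤ Λ := by
    refine Real.log_le_log (by positivity) ?_
    gcongr
  set s := V * b / L with hs
  have hs1 : 1 ≤ s := by
    rw [hs, le_div_iff₀ hL]; nlinarith
  have hn : (10 ^ 6 * s * Λ) ^ 4 ≤ m * ε * δ := by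
    have h1 : V ^ 4 ≤ V ^ (9 / 2 : ℝ) := by
      rw [← Real.rpow_natCast]
      exact Real.rpow_le_rpow_of_exponent_le hV1 (by norm_num)
    have h2 : 1 / (ε * δ) ≤ 1 / ε ^ (3 / 2 : ℝ) + 1 / (ε * δ) :=
      le_add_of_nonneg_left (by positivity)
    have h3 : (10 : ℝ) ^ 24 * (1 * V ^ 4 * b ^ 4 / L ^ 4 * Λ ^ 4 * (1 / (ε * δ))) ≤ m := by
      refine le_trans ?_ hm
      gcongr
    have h4 := mul_le_mul_of_nonneg_right h3 hεδ0.le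
    calc (10 ^ 6 * s * Λ) ^ 4
        = (10 : ℝ) ^ 24 * (1 * V ^ 4 * b ^ 4 / L ^ 4 * Λ ^ 4 * (1 / (ε * δ))) * (ε * δ) := by
          rw [hs]; field_simp
      _ ≤ m * (ε * δ) := h4
      _ = m * ε * δ := by ring
  set n := m * ε * δ with hnd
  have hn0 : 0 < n := lt_of_lt_of_le (by positivity) hn
  have hm0 : (0 : ℝ) < m := by
    by_contra! h
    have : n ≤ 0 := by
      rw [hnd, mul_assoc]; exact mul_nonpos_of_nonpos_of_nonneg h hεδ0.le
    linarith
  -- In terms of the fourth root `x` of `n`, the self-referential logarithm `ℓ`, which contains `m`,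
  -- is at most linear in `x`. So `ℓ ^ 2` costs `x ^ 2`, and the remaining `x ^ 2` absorbs `s ^ 2`.
  obtain ⟨x, hx0, hxn⟩ : ∃ x : ℝ, 0 ≤ x ∧ x ^ 4 = n :=
    ⟨√√n, by positivity, by
      rw [show (4 : ℕ) = 2 * 2 from rfl, pow_mul, Real.sq_sqrt (by positivity),
        Real.sq_sqrt hn0.le]⟩
  have hx : 10 ^ 6 * s * Λ ≤ x := by
    rw [← hxn] at hn
    exact le_of_pow_le_pow_left₀ (by norm_num) hx0 hn
  have hsΛ : 0.69 * s ≤ s * Λ := by nlinarith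
  have hΛs : Λ ≤ s * Λ := by nlinarith
  have hxs : 690000 * s ≤ x := by linarith
  have hxΛ : 1000000 * Λ ≤ x := by linarith
  have hx1 : 1 ≤ x := by linarith
  set ℓ := Real.log (40 * m / (δ * L ^ 2)) with hℓ
  have hℓu : ℓ ≤ 11 * x := by
    have hle : 40 * m / (δ * L ^ 2) ≤ 40 * x ^ 4 * (1 / (ε * δ)) ^ 2 * s ^ 2 := by
      have h1 : 1 / L ≤ s := by
        rw [hs]; gcongr; nlinarith
      have h2 : 40 * m / (δ * L ^ 2) = 40 * n * (1 / (ε * δ ^ 2)) * (1 / L) ^ 2 := by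
        rw [hnd]; field_simp
      have h3 : 1 / (ε * δ ^ 2) ≤ (1 / (ε * δ)) ^ 2 := by
        rw [div_pow, one_pow, mul_pow]
        gcongr
        nlinarith
      rw [h2, hxn]
      gcongr
    have h := Real.log_le_log (by positivity) hle
    have hx0' : 0 < x := by linarith
    rw [Real.log_mul (by positivity) (by positivity), Real.log_mul (by positivity) (by positivity),
      Real.log_mul (by positivity) (by positivity), Real.log_pow, Real.log_pow, Real.log_pow] at h
    have h40 : Real.log 40 ≤ 5 := by
      have h64 := Real.log_le_log (by norm_num) (show (40 : ℝ) ≤ 64 by norm_num)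
      rw [show (64 : ℝ) = 2 ^ 6 by norm_num, Real.log_pow] at h64
      have := Real.log_two_lt_d9
      push_cast at h64
      linarith
    have hlx := Real.log_le_sub_one_of_pos hx0'
    have hls := Real.log_le_sub_one_of_pos (show 0 < s by linarith)
    push_cast at h
    linarith
  have hmδ : 10 ^ 9 ≤ m * δ * L ^ 4 := by
    have h1 : n ≤ m * δ := by
      rw [hnd]
      have : ε * (m * δ) ≤ 1 * (m * δ) := by gcongr
      linarith
    have h2 : (10 ^ 6 * 0.69 * (1 / L)) ^ 4 ≤ (10 ^ 6 * s * Λ) ^ 4 := by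
      have h1 : 1 / L ≤ s := by
        rw [hs]; gcongr; nlinarith
      have : 10 ^ 6 * 0.69 * (1 / L) ≤ 10 ^ 6 * s * Λ := by nlinarith
      gcongr
    have h3 := mul_le_mul_of_nonneg_right (h2.trans (hn.trans h1)) (show 0 ≤ L ^ 4 by positivity)
    have h4 : (10 ^ 6 * 0.69 * (1 / L)) ^ 4 * L ^ 4 = (10 ^ 6 * 0.69) ^ 4 := by
      field_simp
    rw [h4] at h3
    have h5 : (10 : ℝ) ^ 9 ≤ (10 ^ 6 * 0.69) ^ 4 := by norm_num
    exact h5.trans h3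
  have hL2 : L ^ 4 ≤ L ^ 2 := pow_le_pow_of_le_one hL.le hL1 (by norm_num)
  have hℓ1 : 1 ≤ ℓ := by
    rw [hℓ, Real.le_log_iff_exp_le (by positivity), le_div_iff₀ (by positivity)]
    have he := Real.exp_one_lt_d9
    have hmm : (10 : ℝ) ^ 9 ≤ m := by
      refine hmδ.trans ?_
      have : δ * L ^ 4 ≤ 1 := mul_le_one₀ (by linarith) (by positivity) (pow_le_one₀ hL.le hL1)
      rw [mul_assoc]
      exact mul_le_of_le_one_right hm0.le this
    have : δ * L ^ 2 ≤ 1 := mul_le_one₀ (by linarith) (by positivity) (pow_le_one₀ hL.le hL1)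
    have h1 : Real.exp 1 * (δ * L ^ 2) ≤ Real.exp 1 :=
      mul_le_of_le_one_right (Real.exp_pos 1).le this
    have h2 : (3 : ℝ) ≤ 10 ^ 9 := by norm_num
    linarith
  refine ⟨by exact_mod_cast hm0, hmδ, hℓ1, ?_⟩
  have hsL : b * V = s * L := by rw [hs]; field_simp
  calc 10 ^ 9 * (b * V * ℓ) ^ 2 ≤ 10 ^ 9 * (b * V * (11 * x)) ^ 2 := by gcongr
    _ = 121 * 10 ^ 9 * s ^ 2 * x ^ 2 * L ^ 2 := by rw [hsL]; ring
    _ ≤ x ^ 2 * x ^ 2 * L ^ 2 := by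
        have : 121 * 10 ^ 9 * s ^ 2 ≤ x ^ 2 := by
          have := pow_le_pow_left₀ (by positivity) hxs 2
          nlinarith [sq_nonneg s]
        gcongr
    _ = n * L ^ 2 := by rw [← hxn]; ring

end SampleSize

/-! ### Deterministic assembly on a good sample -/

section Assembly

/-- Cauchy–Schwarz: `1.1 A + √E₂ ≤ √2.21 √(A² + E₂) ≤ √(2.21 * 1.1 O) < 1.6 √O`. Bounding both parts
separately by `√O` would exceed the factor `2`. -/
theorem noise_budget {O E₁ E₂ ε X : ℝ} (hE₁ : 0 ≤ E₁) (hE₂ : 0 ≤ E₂) (hO : E₁ + E₂ ≤ O)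
    (hε : 0 ≤ ε) (hX : X ≤ E₁ + (O + ε) / 10) :
    1.1 * √X + √E₂ + 0.1 * (√O + √ε) ≤ 2 * √O + √ε := by
  have hO0 : 0 ≤ O := by linarith
  set A := √(E₁ + O / 10) with hA
  have hA2 : A ^ 2 = E₁ + O / 10 := Real.sq_sqrt (by positivity)
  have hB2 : √E₂ ^ 2 = E₂ := Real.sq_sqrt hE₂
  have hO2 : √O ^ 2 = O := Real.sq_sqrt hO0
  have hε2 : √ε ^ 2 = ε := Real.sq_sqrt hε
  have hXA : √X ≤ A + 0.32 * √ε := by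
    refine Real.sqrt_le_iff.2 ⟨by positivity, hX.trans ?_⟩
    have : 0 ≤ A * √ε := by positivity
    nlinarith
  have hAB : 1.1 * A + √E₂ ≤ 1.6 * √O := by
    refine (le_abs_self _).trans (abs_le_of_sq_le_sq ?_ (by positivity))
    nlinarith [sq_nonneg (A - 1.1 * √E₂)]
  have := Real.sqrt_nonneg O
  have := Real.sqrt_nonneg ε
  linarith

/-- The alignment inequality on a sample with controlled noise. -/
theorem alignment_of_controlled_noise {m : ℕ} {a b ε N O E₁ E₂ G : ℝ}
    {z t y ξ₁ ξ₂ : Fin m → ℝ} {u f : ℝ → ℝ} (ha : 0 < a) (hb : 0 < b) (hε : 0 ≤ ε) (hN : 0 ≤ N)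
    (hE₁ : 0 ≤ E₁) (hE₂ : 0 ≤ E₂) (hO : E₁ + E₂ ≤ O)
    (hu : u ∈ activations a b) (hf : f ∈ activations a b)
    (hmin : ∀ v ∈ activations a b, ∑ i, (u (z i) - y i) ^ 2 ≤ ∑ i, (v (z i) - y i) ^ 2)
    (hy : ∀ i, y i = f (t i) + ξ₁ i + ξ₂ i)
    (h₁ : (1 / (m : ℝ)) * ∑ i, ξ₁ i ^ 2 ≤ E₁ + (O + ε) / 40)
    (h₂ : ∀ v ∈ activations a b, ∀ v' ∈ activations a b,
      (1 / (m : ℝ)) * ∑ i, ξ₂ i * (v (z i) - v' (z i)) ≤ 3 / 80 * (O + ε))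
    (h₃ : (1 / (m : ℝ)) * ∑ i, ξ₂ i * (z i - t i) ≤ (√E₂ + 0.1 * (√O + √ε)) * N)
    (h₄ : (1 / (m : ℝ)) * ∑ i, (z i - t i) ^ 2 ≤ 1.21 * N ^ 2)
    (h₅ : ∀ v ∈ activations a b, G ≤ (1 / (m : ℝ)) * ∑ i, (v (z i) - f (t i)) ^ 2) :
    1 / b * G - (2 * √O + √ε) * N ≤ (1 / (m : ℝ)) * ∑ i, (u (z i) - y i) * (z i - t i) := by
  obtain ⟨u', hu', hmin'⟩ := exists_bestFit z (fun i => f (t i)) hu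
  have hstab := bestFit_stability hu hu' hmin hmin'
  set c : ℝ := 1 / (m : ℝ) with hc
  have hc0 : 0 ≤ c := by positivity
  set X := c * ∑ i, (u (z i) - u' (z i) - ξ₁ i) ^ 2 with hX
  have hX0 : 0 ≤ X := by positivity
  -- Firm nonexpansiveness is used with factor `2` to complete the square around `ξ₁`; what remains
  -- is the energy of `ξ₁` and a correlation with `ξ₂`. The constants add up as `1 / 40 + 2 * 3 / 80
  -- = 1 / 10`.
  have hXle : X ≤ E₁ + (O + ε) / 10 := by
    have e : ∑ i, (u (z i) - u' (z i) - ξ₁ i) ^ 2 = 2 * ∑ i, (u (z i) - u' (z i)) ^ 2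
        - 2 * ∑ i, (y i - f (t i)) * (u (z i) - u' (z i))
        + 2 * ∑ i, ξ₂ i * (u (z i) - u' (z i)) + ∑ i, ξ₁ i ^ 2
        - ∑ i, (u (z i) - u' (z i)) ^ 2 := by
      simp only [Finset.mul_sum]
      rw [← Finset.sum_sub_distrib, ← Finset.sum_add_distrib, ← Finset.sum_add_distrib,
        ← Finset.sum_sub_distrib]
      exact Finset.sum_congr rfl fun i _ => by rw [hy]; ring
    have h0 : 0 ≤ ∑ i, (u (z i) - u' (z i)) ^ 2 := Finset.sum_nonneg fun i _ => sq_nonneg _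
    have h : ∑ i, (u (z i) - u' (z i) - ξ₁ i) ^ 2
        ≤ 2 * ∑ i, ξ₂ i * (u (z i) - u' (z i)) + ∑ i, ξ₁ i ^ 2 := by linarith
    have h' := mul_le_mul_of_nonneg_left h hc0
    have h2 := h₂ u hu u' hu'
    rw [hX]
    linarith
  have hcs : -(1.1 * √X * N) ≤ c * ∑ i, (u (z i) - u' (z i) - ξ₁ i) * (z i - t i) := by
    have h := Finset.sum_mul_sq_le_sq_mul_sq Finset.univ
      (fun i => u (z i) - u' (z i) - ξ₁ i) fun i => z i - t i
    have h' : (c * ∑ i, (u (z i) - u' (z i) - ξ₁ i) * (z i - t i)) ^ 2 ≤ (1.1 * √X * N) ^ 2 := by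
      calc (c * ∑ i, (u (z i) - u' (z i) - ξ₁ i) * (z i - t i)) ^ 2
          = c ^ 2 * (∑ i, (u (z i) - u' (z i) - ξ₁ i) * (z i - t i)) ^ 2 := by ring
        _ ≤ c ^ 2 * ((∑ i, (u (z i) - u' (z i) - ξ₁ i) ^ 2) * ∑ i, (z i - t i) ^ 2) := by gcongr
        _ = X * (c * ∑ i, (z i - t i) ^ 2) := by rw [hX]; ring
        _ ≤ X * (1.21 * N ^ 2) := by gcongr
        _ = (1.1 * √X * N) ^ 2 := by
          rw [mul_pow, mul_pow, Real.sq_sqrt hX0]; ring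
    exact (abs_le.1 (abs_le_of_sq_le_sq h' (by positivity))).1
  have hsig : 1 / b * G ≤ c * ∑ i, (u' (z i) - f (t i)) * (z i - t i) := by
    refine le_of_forall_pos_le_add fun e he => ?_
    -- The regularization is chosen so that its cost `η / 4` times the mean of `(z - t)²` is at most
    -- `e`.
    have hη : 0 < 4 * e / (1.21 * N ^ 2 + 1) := by positivity
    obtain ⟨v, hv, hle⟩ := bestFit_noiseless_alignment ha hb hu' hf hmin' hη
    have hle' := mul_le_mul_of_nonneg_left hle hc0
    have hG := mul_le_mul_of_nonneg_left (h₅ v hv) (show 0 ≤ 1 / b by positivity)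
    have he2 : 4 * e / (1.21 * N ^ 2 + 1) / 4 * (c * ∑ i, (z i - t i) ^ 2) ≤ e := by
      calc 4 * e / (1.21 * N ^ 2 + 1) / 4 * (c * ∑ i, (z i - t i) ^ 2)
          ≤ 4 * e / (1.21 * N ^ 2 + 1) / 4 * (1.21 * N ^ 2) := by gcongr
        _ = e * ((1.21 * N ^ 2) / (1.21 * N ^ 2 + 1)) := by ring
        _ ≤ e * 1 := by
          gcongr
          rw [div_le_one (by positivity)]
          linarith
        _ = e := mul_one e
    have e3 : c * (1 / b * ∑ i, (v (z i) - f (t i)) ^ 2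
        - 4 * e / (1.21 * N ^ 2 + 1) / 4 * ∑ i, (z i - t i) ^ 2)
        = 1 / b * (c * ∑ i, (v (z i) - f (t i)) ^ 2)
          - 4 * e / (1.21 * N ^ 2 + 1) / 4 * (c * ∑ i, (z i - t i) ^ 2) := by ring
    rw [e3] at hle'
    linarith
  have hsplit : c * ∑ i, (u (z i) - y i) * (z i - t i)
      = c * ∑ i, (u' (z i) - f (t i)) * (z i - t i)
        + c * ∑ i, (u (z i) - u' (z i) - ξ₁ i) * (z i - t i)
        - c * ∑ i, ξ₂ i * (z i - t i) := by
    rw [← mul_add, ← mul_sub, ← Finset.sum_add_distrib, ← Finset.sum_sub_distrib]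
    congr 1
    exact Finset.sum_congr rfl fun i _ => by rw [hy]; ring
  have hbud := mul_le_mul_of_nonneg_right (noise_budget hE₁ hE₂ hO hε hXle) hN
  rw [hsplit]
  linarith

theorem abs_integral_mul_le {Ω : Type*} [MeasurableSpace Ω] {μ : Measure Ω} {f g : Ω → ℝ}
    (hf : MemLp f 2 μ) (hg : MemLp g 2 μ) {A B : ℝ} (hA : ∫ x, f x ^ 2 ∂μ ≤ A)
    (hB : ∫ x, g x ^ 2 ∂μ ≤ B ^ 2) (hB0 : 0 ≤ B) : |∫ x, f x * g x ∂μ| ≤ √A * B := by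
  have hfi := hf.integrable_sq
  have hgi := hg.integrable_sq
  have hfg : Integrable (fun x => f x * g x) μ := hf.integrable_mul hg
  -- The integral of `(s * g - f) ^ 2` is a nonnegative quadratic in `s`; its discriminant gives
  -- Cauchy–Schwarz.
  have hq : ∀ s : ℝ, 0 ≤ (∫ x, g x ^ 2 ∂μ) * (s * s) + (-2 * ∫ x, f x * g x ∂μ) * s
      + ∫ x, f x ^ 2 ∂μ := by
    intro s
    have h : 0 ≤ ∫ x, (g x ^ 2 * (s * s) + f x * g x * (-2 * s) + f x ^ 2) ∂μ :=
      integral_nonneg fun x => by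
        have := sq_nonneg (g x * s - f x)
        simp only [Pi.zero_apply]
        nlinarith
    have hsum : Integrable (fun x => g x ^ 2 * (s * s) + f x * g x * (-2 * s)) μ :=
      (hgi.mul_const _).add (hfg.mul_const _)
    rw [integral_add hsum hfi,
      integral_add (hgi.mul_const _) (hfg.mul_const _), integral_mul_const,
      integral_mul_const] at h
    linarith
  have hd := discrim_le_zero hq
  rw [discrim] at hd
  have hf0 : 0 ≤ ∫ x, f x ^ 2 ∂μ := integral_nonneg fun x => sq_nonneg _
  have hg0 : 0 ≤ ∫ x, g x ^ 2 ∂μ := integral_nonneg fun x => sq_nonneg _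
  refine abs_le_of_sq_le_sq ?_ (by positivity)
  rw [mul_pow, Real.sq_sqrt (hf0.trans hA)]
  nlinarith [mul_le_mul hA hB hg0 (hf0.trans hA)]

end Assembly

/-! ### Truncated noise: low-part energy and high-part correlations -/

section NoiseTruncation

variable {Ω : Type*}

/-- The part of `ξ` of magnitude at most `M`. -/
noncomputable def lowPart (M : ℝ) (ξ : Ω → ℝ) (p : Ω) : ℝ :=
  {p | |ξ p| ≤ M}.indicator ξ p

/-- The part of `ξ` of magnitude greater than `M`. -/
noncomputable def highPart (M : ℝ) (ξ : Ω → ℝ) (p : Ω) : ℝ :=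
  {p | M < |ξ p|}.indicator ξ p

theorem lowPart_add_highPart (M : ℝ) (ξ : Ω → ℝ) (p : Ω) :
    lowPart M ξ p + highPart M ξ p = ξ p := by
  by_cases h : |ξ p| ≤ M
  · simp [lowPart, highPart, h, not_lt.2 h]
  · simp [lowPart, highPart, h, not_le.1 h]

theorem lowPart_sq_add_highPart_sq (M : ℝ) (ξ : Ω → ℝ) (p : Ω) :
    lowPart M ξ p ^ 2 + highPart M ξ p ^ 2 = ξ p ^ 2 := by
  by_cases h : |ξ p| ≤ M
  · simp [lowPart, highPart, h, not_lt.2 h]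
  · simp [lowPart, highPart, h, not_le.1 h]

theorem lowPart_sq_le (M : ℝ) (ξ : Ω → ℝ) (p : Ω) : lowPart M ξ p ^ 2 ≤ M ^ 2 := by
  by_cases h : |ξ p| ≤ M
  · simp only [lowPart, Set.indicator, Set.mem_ofPred_eq, h, if_true]
    rw [← sq_abs]
    exact pow_le_pow_left₀ (abs_nonneg _) h 2
  · simp [lowPart, h]
    positivity

theorem abs_highPart_le {M : ℝ} (hM : 0 < M) (ξ : Ω → ℝ) (p : Ω) :
    |highPart M ξ p| ≤ ξ p ^ 2 / M := by
  by_cases h : M < |ξ p|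
  · simp only [highPart, Set.indicator, Set.mem_ofPred_eq, h, if_true]
    rw [le_div_iff₀ hM, ← sq_abs]
    nlinarith
  · simp [highPart, h]
    positivity

variable [MeasurableSpace Ω] {D : Measure Ω}

theorem measurable_lowPart {M : ℝ} {ξ : Ω → ℝ} (hξ : Measurable ξ) :
    Measurable (lowPart M ξ) :=
  hξ.indicator (measurableSet_le (by fun_prop) (by fun_prop))

theorem measurable_highPart {M : ℝ} {ξ : Ω → ℝ} (hξ : Measurable ξ) :
    Measurable (highPart M ξ) :=
  hξ.indicator (measurableSet_lt (by fun_prop) (by fun_prop))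

theorem memLp_lowPart {M : ℝ} {ξ : Ω → ℝ} (hξ : Measurable ξ) (h2 : MemLp ξ 2 D) :
    MemLp (lowPart M ξ) 2 D :=
  h2.indicator (measurableSet_le (by fun_prop) (by fun_prop))

theorem memLp_highPart {M : ℝ} {ξ : Ω → ℝ} (hξ : Measurable ξ) (h2 : MemLp ξ 2 D) :
    MemLp (highPart M ξ) 2 D :=
  h2.indicator (measurableSet_lt (by fun_prop) (by fun_prop))

theorem integral_lowPart_sq_add {M : ℝ} {ξ : Ω → ℝ} (hξ : Measurable ξ) (h2 : MemLp ξ 2 D) :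
    ∫ p, lowPart M ξ p ^ 2 ∂D + ∫ p, highPart M ξ p ^ 2 ∂D = ∫ p, ξ p ^ 2 ∂D := by
  rw [← integral_add (memLp_lowPart hξ h2).integrable_sq (memLp_highPart hξ h2).integrable_sq]
  exact integral_congr_ae (Filter.Eventually.of_forall fun p => lowPart_sq_add_highPart_sq M ξ p)

variable [IsProbabilityMeasure D]

/-- Truncation bounds the fourth moment by `M ^ 2 * O`, so Chebyshev applies to the squares. The
inequality `4 * ε * O ≤ (O + ε) ^ 2` turns the mixed scale into the stated threshold. -/
theorem measure_lowPart_sq_deviation_le {m : ℕ} (hm : 0 < m) {ξ : Ω → ℝ} (hξ : Measurable ξ)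
    (h2 : MemLp ξ 2 D) {M ε δ O : ℝ} (hO : ∫ p, ξ p ^ 2 ∂D = O) (hε : 0 < ε)
    (hδ : 0 < δ) (hMm : 2800 * M ^ 2 ≤ m * ε * δ) :
    (Measure.pi fun _ : Fin m => D) {S | (O + ε) / 40 ≤
      |(1 / (m : ℝ)) * ∑ i, lowPart M ξ (S i) ^ 2 - ∫ p, lowPart M ξ p ^ 2 ∂D|}
      ≤ ENNReal.ofReal (δ / 7) := by
  have hO0 : 0 ≤ O := hO ▸ integral_nonneg fun p => sq_nonneg _
  have hmem : MemLp (fun p => lowPart M ξ p ^ 2) 2 D := by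
    refine MemLp.of_bound ((measurable_lowPart hξ).pow_const 2).aestronglyMeasurable (M ^ 2)
      (Filter.Eventually.of_forall fun p => ?_)
    rw [Real.norm_of_nonneg (sq_nonneg _)]
    exact lowPart_sq_le M ξ p
  refine measure_sampleMean_deviation_le D hm hmem (by positivity) ?_
  have h1 : ∫ p, (lowPart M ξ p ^ 2) ^ 2 ∂D ≤ M ^ 2 * O := by
    rw [← hO, ← integral_const_mul]
    refine integral_mono hmem.integrable_sq (h2.integrable_sq.const_mul _) fun p => ?_
    have h3 := lowPart_sq_le M ξ p
    have h4 := lowPart_sq_add_highPart_sq M ξ p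
    have h5 := sq_nonneg (highPart M ξ p)
    simp only
    rw [pow_two (lowPart M ξ p ^ 2)]
    exact mul_le_mul h3 (by linarith) (sq_nonneg _) (sq_nonneg _)
  have h3 := mul_le_mul_of_nonneg_right hMm hO0
  have h4 : m * δ * (4 * (ε * O)) ≤ m * δ * (O + ε) ^ 2 := by
    gcongr
    nlinarith [sq_nonneg (O - ε)]
  nlinarith

/-- Duality reduces all pairs of activations to one random integral, controlled by Markov with
second moments only. The centering is harmless: above the truncation level `|ξ| ≤ ξ ^ 2 / M`, so the
means are at most `O / M`. -/
theorem measure_highPart_process_le {m : ℕ} (hm : 0 < m) {ξ Z : Ω → ℝ} (hξ : Measurable ξ)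
    (hZ : Measurable Z) (h2 : MemLp ξ 2 D) {M B a b ε δ O : ℝ} (hM : 0 < M) (hB : 0 < B)
    (hb : 0 < b) (hO : ∫ p, ξ p ^ 2 ∂D = O) (hε : 0 < ε) (hδ : 0 < δ)
    (hBm : 44800 * (b * B) ^ 2 ≤ m * ε * δ) (hBM : 80 * (b * B) ≤ M) :
    ∃ T : Set (Fin m → Ω), (Measure.pi fun _ : Fin m => D) T ≤ ENNReal.ofReal (δ / 7) ∧
      ∀ S, S ∉ T → (∀ i, |Z (S i)| ≤ B) → ∀ u ∈ activations a b, ∀ v ∈ activations a b,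
        (1 / (m : ℝ)) * ∑ i, highPart M ξ (S i) * (u (Z (S i)) - v (Z (S i)))
          ≤ 3 / 80 * (O + ε) := by
  have hO0 : 0 ≤ O := hO ▸ integral_nonneg fun p => sq_nonneg _
  have hm' : (0 : ℝ) < m := by positivity
  set F : ℝ → Ω → ℝ := fun t p => highPart M ξ p * stepKernel t (Z p) with hF
  have hFm : Measurable fun q : ℝ × Ω => F q.1 q.2 :=
    ((measurable_highPart hξ).comp measurable_snd).mul
      (measurable_stepKernel.comp (measurable_fst.prodMk (hZ.comp measurable_snd)))
  have hFt : ∀ t, Measurable (F t) := fun t => hFm.comp (measurable_const.prodMk measurable_id)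
  have hFabs : ∀ t p, |F t p| ≤ |highPart M ξ p| := by
    intro t p
    rw [hF, abs_mul]
    exact mul_le_of_le_one_right (abs_nonneg _) (abs_stepKernel_le_one _ _)
  have hhi := memLp_highPart (M := M) hξ h2
  have hFL : ∀ t, MemLp (F t) 2 D := fun t => hhi.mono (hFt t).aestronglyMeasurable
    (Filter.Eventually.of_forall fun p => hFabs t p)
  have hV : ∀ t, ∫ p, F t p ^ 2 ∂D ≤ O := by
    intro t
    rw [← hO]
    refine integral_mono (hFL t).integrable_sq h2.integrable_sq fun p => ?_
    have h3 : F t p ^ 2 ≤ highPart M ξ p ^ 2 := sq_le_sq.2 (hFabs t p)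
    have h4 := lowPart_sq_add_highPart_sq M ξ p
    have h5 := sq_nonneg (lowPart M ξ p)
    simp only
    linarith
  have hmean : ∀ t, |∫ p, F t p ∂D| ≤ O / M := by
    intro t
    rw [← hO, ← Real.norm_eq_abs, ← integral_div]
    exact norm_integral_le_of_norm_le (h2.integrable_sq.div_const M)
      (Filter.Eventually.of_forall fun p => (hFabs t p).trans (abs_highPart_le hM ξ p))
  set κ := (O + ε) / 80 with hκ
  have hκ0 : 0 < κ := by positivity
  set τ := κ ^ 2 / (2 * B * b ^ 2) with hτ
  have hτ0 : 0 < τ := by positivity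
  refine ⟨_, measure_integrated_deviation_le D hm hFm hFL hV hτ0 hB.le (p := δ / 7) ?_, ?_⟩
  · rw [hτ, show m * (κ ^ 2 / (2 * B * b ^ 2)) * (δ / 7) = m * δ * κ ^ 2 / (14 * B * b ^ 2) by
      field_simp; norm_num, le_div_iff₀ (by positivity)]
    have h3 := mul_le_mul_of_nonneg_right hBm hO0
    have h4 : m * δ * (4 * (ε * O)) ≤ m * δ * (O + ε) ^ 2 := by
      gcongr
      nlinarith [sq_nonneg (O - ε)]
    rw [hκ]
    nlinarith
  · intro S hS hZB u hu v hv
    simp only [Set.mem_ofPred_eq, not_le] at hS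
    set l := κ / (2 * b * B) with hl
    have hbK : ((b.toNNReal : NNReal) : ℝ) = b := Real.coe_toNNReal b hb.le
    have hLip : LipschitzWith b.toNNReal fun z => u z - v z := by
      refine LipschitzWith.of_dist_le_mul fun x y => ?_
      rw [Real.dist_eq, Real.dist_eq, hbK]
      have key : ∀ x y, y ≤ x → |u x - v x - (u y - v y)| ≤ b * |x - y| := by
        intro x y hxy
        have h3 := hu.2.1 hxy
        have h4 := hv.2.1 hxy
        have h5 := (le_abs_self _).trans (hu.2.2.1 x y)
        have h6 := (le_abs_self _).trans (hv.2.2.1 x y)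
        rw [abs_le]
        constructor <;> linarith
      rcases le_total y x with h | h
      · exact key x y h
      · rw [abs_sub_comm, abs_sub_comm x]
        exact key y x h
    have h := abs_sum_mul_le_of_lipschitz hLip (by simp [hu.1, hv.1])
      (c := fun i => 1 / (m : ℝ) * highPart M ξ (S i)) (z := fun i => Z (S i)) (B := B)
      (H := O / M) (T := τ) (l := l) hB.le (by positivity) hτ0.le hZB
      (h := fun t => ∫ p, F t p ∂D)
      (StronglyMeasurable.integral_prod_right (f := fun t p => F t p)
        hFm.stronglyMeasurable).measurable hmean (by
        refine le_trans (le_of_eq ?_) hS.le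
        refine lintegral_congr fun t => ?_
        congr 3
        exact Finset.sum_congr rfl fun i _ => by rw [hF]; ring)
    rw [hbK] at h
    have e : (1 / (m : ℝ)) * ∑ i, highPart M ξ (S i) * (u (Z (S i)) - v (Z (S i)))
        = ∑ i, 1 / (m : ℝ) * highPart M ξ (S i) * (u (Z (S i)) - v (Z (S i))) := by
      rw [Finset.mul_sum]
      exact Finset.sum_congr rfl fun i _ => by ring
    rw [e]
    refine (le_abs_self _).trans (h.trans ?_)
    -- `τ` and `l` are chosen so that the two AM–GM terms are equal, each contributing `κ / 2`. The
    -- means add at most `O / 40`, whence `3 / 80`.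
    have h3 : b * (τ / (2 * l) + l * B) = κ := by
      rw [hτ, hl]; field_simp; norm_num
    have h4 : 2 * b * B * (O / M) ≤ O / 40 := by
      rw [mul_div_assoc', div_le_iff₀ hM]
      nlinarith
    rw [h3, hκ]
    linarith

/-- The product of the noise with `q` need not be square integrable, so `q` is cut at `N * s`, a
level not exceeded on the sample. The mean of the cut product is bounded by Cauchy–Schwarz, its
fluctuation by Chebyshev. -/
theorem measure_highPart_linear_le {m : ℕ} (hm : 0 < m) {ξ q : Ω → ℝ} (hξ : Measurable ξ)
    (hq : Measurable q) (h2 : MemLp ξ 2 D) (hq2 : MemLp q 2 D) {M ε δ O N s : ℝ} (hN : 0 < N)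
    (hqN : ∫ p, q p ^ 2 ∂D ≤ N ^ 2) (hs : 0 ≤ s)
    (hO : ∫ p, ξ p ^ 2 ∂D = O) (hε : 0 < ε) (hδ : 0 < δ) (hsm : 700 * s ^ 2 ≤ m * δ) :
    ∃ T : Set (Fin m → Ω), (Measure.pi fun _ : Fin m => D) T ≤ ENNReal.ofReal (δ / 7) ∧
      ∀ S, S ∉ T → (∀ i, |q (S i)| ≤ N * s) →
        (1 / (m : ℝ)) * ∑ i, highPart M ξ (S i) * q (S i)
          ≤ (√(∫ p, highPart M ξ p ^ 2 ∂D) + 0.1 * (√O + √ε)) * N := by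
  have hO0 : 0 ≤ O := hO ▸ integral_nonneg fun p => sq_nonneg _
  set A : Set Ω := {p | |q p| ≤ N * s} with hA
  have hAm : MeasurableSet A := measurableSet_le (by fun_prop) (by fun_prop)
  have hhi := memLp_highPart (M := M) hξ h2
  have hqA : MemLp (A.indicator q) 2 D := hq2.indicator hAm
  set f : Ω → ℝ := fun p => highPart M ξ p * A.indicator q p with hf
  have hqb : ∀ p, |A.indicator q p| ≤ N * s := by
    intro p
    by_cases hp : p ∈ A
    · rw [Set.indicator_of_mem hp]; exact hp
    · simp [hp]; positivity
  have hfm : Measurable f := (measurable_highPart hξ).mul (hq.indicator hAm)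
  have hfabs : ∀ p, |f p| ≤ |(N * s) * highPart M ξ p| := by
    intro p
    rw [hf, abs_mul, abs_mul, mul_comm, abs_of_nonneg (show 0 ≤ N * s by positivity)]
    exact mul_le_mul_of_nonneg_right (hqb p) (abs_nonneg _)
  have hf2 : MemLp f 2 D := (hhi.const_mul (N * s)).mono hfm.aestronglyMeasurable
    (Filter.Eventually.of_forall hfabs)
  have hthr : 0 < 0.1 * (√O + √ε) * N := by
    have := Real.sqrt_pos.2 hε
    positivity
  refine ⟨_, measure_sampleMean_deviation_le D hm hf2 hthr (p := δ / 7) ?_, ?_⟩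
  · have h3 : ∫ p, f p ^ 2 ∂D ≤ (N * s) ^ 2 * O := by
      rw [← hO, ← integral_const_mul]
      refine integral_mono hf2.integrable_sq (h2.integrable_sq.const_mul _) fun p => ?_
      have h4 := sq_le_sq.2 (hfabs p)
      have h5 := lowPart_sq_add_highPart_sq M ξ p
      have h6 := sq_nonneg (lowPart M ξ p)
      simp only
      refine h4.trans ?_
      rw [mul_pow]
      exact mul_le_mul_of_nonneg_left (by linarith) (sq_nonneg _)
    refine h3.trans ?_
    have h4 : O ≤ (√O + √ε) ^ 2 := by
      have := Real.sq_sqrt hO0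
      have := Real.sqrt_nonneg O
      have := Real.sqrt_nonneg ε
      nlinarith
    calc (N * s) ^ 2 * O = N ^ 2 / 700 * (700 * s ^ 2) * O := by ring
      _ ≤ N ^ 2 / 700 * (m * δ) * (√O + √ε) ^ 2 := by gcongr
      _ = m * (0.1 * (√O + √ε) * N) ^ 2 * (δ / 7) := by ring
  · intro S hS hb
    simp only [Set.mem_ofPred_eq, not_le] at hS
    have e : ∑ i, highPart M ξ (S i) * q (S i) = ∑ i, f (S i) := by
      refine Finset.sum_congr rfl fun i _ => ?_
      have : S i ∈ A := hb i
      simp [hf, this]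
    have hcs := abs_integral_mul_le hhi hqA le_rfl (B := N) (by
      refine le_trans ?_ hqN
      refine integral_mono hqA.integrable_sq hq2.integrable_sq fun p => ?_
      by_cases hp : p ∈ A
      · simp [hp]
      · simp [hp]; positivity) hN.le
    rw [e]
    have h3 := (abs_lt.1 hS).2
    have h4 := (le_abs_self _).trans hcs
    have h5 : ∫ p, f p ∂D = ∫ p, highPart M ξ p * A.indicator q p ∂D := rfl
    linarith

end NoiseTruncation

/-! ### Failure probability and the alignment inequality -/

section Main

variable {d : ℕ} {L R a b W ε δ : ℝ} {D : Measure (EuclideanSpace ℝ (Fin d) × ℝ)}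

theorem inner_empSurrogateGrad {m : ℕ} (S : Fin m → EuclideanSpace ℝ (Fin d) × ℝ)
    (w v : EuclideanSpace ℝ (Fin d)) (u : ℝ → ℝ) :
    ⟪empSurrogateGrad S w u, w - v⟫ = (1 / (m : ℝ)) *
      ∑ i, (u ⟪w, (S i).1⟫ - (S i).2) * (⟪w, (S i).1⟫ - ⟪v, (S i).1⟫) := by
  rw [empSurrogateGrad, real_inner_smul_left, sum_inner]
  congr 1
  refine Finset.sum_congr rfl fun i _ => ?_
  rw [real_inner_smul_left, inner_sub_right, real_inner_comm w, real_inner_comm v]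

theorem IsBestFit.sum_le {m : ℕ} (hm : 0 < m) {S : Fin m → EuclideanSpace ℝ (Fin d) × ℝ}
    {w : EuclideanSpace ℝ (Fin d)} {u : ℝ → ℝ} (h : IsBestFit a b S w u) :
    ∀ v ∈ activations a b, ∑ i, (u ⟪w, (S i).1⟫ - (S i).2) ^ 2
      ≤ ∑ i, (v ⟪w, (S i).1⟫ - (S i).2) ^ 2 := by
  intro v hv
  have hm' : (0 : ℝ) < 1 / m := by positivity
  exact le_of_mul_le_mul_left (h.2 v hv) hm'

theorem memLp_inner [IsProbabilityMeasure D] (hL : 0 < L) (hP : IsWellBehaved L R (D.map Prod.fst))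
    (v : EuclideanSpace ℝ (Fin d)) (n : ℕ) :
    MemLp (fun p : EuclideanSpace ℝ (Fin d) × ℝ => ⟪v, p.1⟫ ^ n) 2 D := by
  have : IsProbabilityMeasure (D.map Prod.fst) :=
    Measure.isProbabilityMeasure_map (by fun_prop)
  rw [memLp_two_iff_integrable_sq (by fun_prop)]
  have h := (integrable_inner_pow hL hP v (n * 2)).comp_measurable measurable_fst
  refine h.congr (Filter.Eventually.of_forall fun p => ?_)
  simp [pow_mul]

theorem memLp_residual [IsProbabilityMeasure D] (hL : 0 < L)
    (hP : IsWellBehaved L R (D.map Prod.fst)) (hy : Integrable (fun p => p.2 ^ 2) D)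
    (v : EuclideanSpace ℝ (Fin d)) {f : ℝ → ℝ} (hf : f ∈ activations a b) :
    MemLp (fun p => p.2 - f ⟪v, p.1⟫) 2 D := by
  have hfc := continuous_of_mem_activations hf
  refine MemLp.sub ((memLp_two_iff_integrable_sq (by fun_prop)).2 hy) ?_
  have h1 : MemLp (fun p : EuclideanSpace ℝ (Fin d) × ℝ => ⟪v, p.1⟫) 2 D := by
    simpa using memLp_inner hL hP v 1
  refine (h1.const_mul b).mono (by fun_prop) (Filter.Eventually.of_forall fun p => ?_)
  rw [Real.norm_eq_abs, Real.norm_eq_abs, abs_mul]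
  refine (abs_le_of_mem_activations hf _).trans ?_
  exact mul_le_mul_of_nonneg_right (le_abs_self b) (abs_nonneg _)

/-- The radius makes the tail of a single sample point exactly `δ / (10 * m)`, ready for the union
bound. -/
theorem measure_exists_large_inner_le [IsProbabilityMeasure D] {m : ℕ} (hm : 0 < m) (hL : 0 < L)
    (hP : IsWellBehaved L R (D.map Prod.fst)) (hδ : 0 < δ) (v : EuclideanSpace ℝ (Fin d)) {r : ℝ}
    (hr : ‖v‖ * (2 * Real.log (40 * m / (δ * L ^ 2)) / L) ≤ r) :
    (Measure.pi fun _ : Fin m => D) {S | ∃ i, S i ∈ {p | r < |⟪v, p.1⟫|}}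
      ≤ ENNReal.ofReal (δ / 10) := by
  have : IsProbabilityMeasure (D.map Prod.fst) :=
    Measure.isProbabilityMeasure_map (by fun_prop)
  have hm' : (0 : ℝ) < m := by positivity
  have hA : MeasurableSet {x : EuclideanSpace ℝ (Fin d) | r < |⟪v, x⟫|} :=
    measurableSet_lt (by fun_prop) (by fun_prop)
  refine measure_exists_mem_le D (hA.preimage measurable_fst) ?_
  have h := measureReal_inner_gt_le hL hP v hr
  rw [map_measureReal_apply measurable_fst hA, show L / 2 * (2 * Real.log (40 * m / (δ * L ^ 2)) / L)
    = Real.log (40 * m / (δ * L ^ 2)) by field_simp, Real.exp_neg, Real.exp_log (by positivity)] at h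
  calc _ ≤ m * (4 / L ^ 2 * (40 * m / (δ * L ^ 2))⁻¹) := mul_le_mul_of_nonneg_left h hm'.le
    _ = δ / 10 := by field_simp; norm_num

theorem measure_sq_inner_le [IsProbabilityMeasure D] {m : ℕ} (hm : 0 < m) (hL : 0 < L)
    (hP : IsWellBehaved L R (D.map Prod.fst)) (hS : SecondMomentLeOne (D.map Prod.fst))
    {v : EuclideanSpace ℝ (Fin d)} (hv : v ≠ 0) (hmδ : 10 ^ 5 ≤ m * δ * L ^ 4) :
    (Measure.pi fun _ : Fin m => D)
      {S | 1.21 * ‖v‖ ^ 2 < (1 / (m : ℝ)) * ∑ i, ⟪v, (S i).1⟫ ^ 2} ≤ ENNReal.ofReal (δ / 7) := by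
  have : IsProbabilityMeasure (D.map Prod.fst) :=
    Measure.isProbabilityMeasure_map (by fun_prop)
  have hN : 0 < ‖v‖ := norm_pos_iff.2 hv
  have h4 := integral_inner_pow_four_le hL hP hS v
  have h2 := hS v
  rw [integral_map (by fun_prop) (by fun_prop)] at h4 h2
  refine le_trans (measure_mono ?_) (measure_sampleMean_deviation_le D hm (memLp_inner hL hP v 2)
    (s := 0.21 * ‖v‖ ^ 2) (p := δ / 7) (by positivity) ?_)
  · intro S hS
    simp only [Set.mem_ofPred_eq] at hS ⊢
    refine le_trans ?_ (le_abs_self _)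
    linarith
  · simp only [← pow_mul, Nat.reduceMul]
    refine h4.trans ?_
    rw [div_mul_eq_mul_div, div_le_iff₀ (by positivity)]
    have h5 := mul_le_mul_of_nonneg_right hmδ (show 0 ≤ ‖v‖ ^ 4 by positivity)
    nlinarith

/-- Either the alignment term is dominated by `ε`, or the empirical error bound holds. -/
theorem exists_empirical_error_bound [IsProbabilityMeasure D] {m : ℕ} (hm : 0 < m) (hL : 0 < L)
    (hR : 0 < R) (hR1 : R ≤ 1) (ha : 0 < a) (hab : a ≤ b) (hε : 0 < ε)
    (hP : IsWellBehaved L R (D.map Prod.fst)) {w v : EuclideanSpace ℝ (Fin d)} (hw : ‖w‖ ≤ W)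
    (hv : ‖v‖ ≤ W) {f : ℝ → ℝ} (hf : f ∈ activations a b)
    (hmW : 2200 * (b * W) ^ 2 ≤ m * ε * δ) :
    ∃ (G : ℝ) (T : Set (Fin m → EuclideanSpace ℝ (Fin d) × ℝ)),
      1 / 768 * a ^ 2 * L * R ^ 4 * ‖perp v w‖ ^ 2 - ε ≤ G ∧
      (Measure.pi fun _ : Fin m => D) T ≤ ENNReal.ofReal (δ / 7) ∧
      ∀ S, S ∉ T → ∀ u ∈ activations a b,
        G ≤ (1 / (m : ℝ)) * ∑ i, (u ⟪w, (S i).1⟫ - f ⟪v, (S i).1⟫) ^ 2 := by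
  have : IsProbabilityMeasure (D.map Prod.fst) :=
    Measure.isProbabilityMeasure_map (by fun_prop)
  have hm' : (0 : ℝ) < m := by positivity
  rcases le_or_gt (1 / 768 * a ^ 2 * L * R ^ 4 * ‖perp v w‖ ^ 2) ε with h | h
  · exact ⟨0, ∅, by linarith, by simp, fun S _ u _ => by positivity⟩
  · have hβ : 0 < ‖perp v w‖ := by
      rw [norm_pos_iff]
      intro h0
      simp only [h0, norm_zero] at h
      linarith
    obtain ⟨κ, _, A, p₀, hAm, hp₀, hAp, hcard, hE⟩ :=
      exists_error_cells hP hL hR hR1 ha hab hw hv hβ hf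
    refine ⟨a ^ 2 * L * R ^ 4 * ‖perp v w‖ ^ 2 / 384, _, ?_, measure_exists_freq_lt_le D hm
      (A := fun j => Prod.fst ⁻¹' A j) (fun j => (hAm j).preimage measurable_fst) hp₀
      (fun j => ?_) (p := δ / 7) ?_, ?_⟩
    · have : 0 ≤ a ^ 2 * L * R ^ 4 * ‖perp v w‖ ^ 2 := by positivity
      linarith
    · rw [← map_measureReal_apply measurable_fst (hAm j)]
      exact hAp j
    -- Outside the trivial case the misalignment is bounded below in terms of `ε`. This bounds the
    -- number of cells relative to `p₀`, so the union bound over cells fits the sample size.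
    · have h1 : 768 * ε ≤ (a * ‖perp v w‖) ^ 2 * (L * R ^ 2) := by
        have h2 : R ^ 4 ≤ R ^ 2 := pow_le_pow_of_le_one hR.le hR1 (by norm_num)
        have h3 : a ^ 2 * L * R ^ 4 * ‖perp v w‖ ^ 2 ≤ a ^ 2 * L * R ^ 2 * ‖perp v w‖ ^ 2 := by
          gcongr
        nlinarith
      have hc0 : (0 : ℝ) ≤ Fintype.card κ := by positivity
      have h2 : Fintype.card κ * (768 * ε) ≤ p₀ * (60000 * (b * W) ^ 2) := by
        refine le_trans ?_ hcard
        rw [mul_assoc]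
        gcongr
      have h3 : p₀ * (2200 * (b * W) ^ 2) ≤ p₀ * (m * ε * δ) := by gcongr
      have h4 : ε * (4 * Fintype.card κ) ≤ ε * (m * p₀ * (δ / 7)) := by nlinarith
      exact le_of_mul_le_mul_left h4 hε
    · intro S hS u hu
      simp only [Set.mem_ofPred_eq, not_exists, not_lt] at hS
      exact hE m (fun i => (S i).1) (fun j => hS j) u hu

set_option maxHeartbeats 2000000 in
theorem measure_alignment_failure_le [IsProbabilityMeasure D] {m : ℕ} (hd : 1 ≤ d) (hL : 0 < L)
    (hL1 : L ≤ 1) (hR : 0 < R) (hR1 : R ≤ 1) (ha : 0 < a) (hab : a ≤ b) (hb : 1 ≤ b)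
    (hε : 0 < ε) (hε1 : ε ≤ 1) (hδ : 0 < δ) (hδ1 : δ ≤ 1 / 2)
    (hP : IsWellBehaved L R (D.map Prod.fst)) (hS : SecondMomentLeOne (D.map Prod.fst))
    (hy : Integrable (fun p => p.2 ^ 2) D) {w v : EuclideanSpace ℝ (Fin d)} {f : ℝ → ℝ}
    (hv : ‖v‖ ≤ W) (hf : f ∈ activations a b) (hw : ‖w‖ ≤ W) (hwv : w ≠ v)
    (hm : (10 : ℝ) ^ 24 * (d * max 1 W ^ (9 / 2 : ℝ) * b ^ 4 / L ^ 4 * Real.log (d / (ε * δ)) ^ 4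
              * (1 / ε ^ (3 / 2 : ℝ) + 1 / (ε * δ))) ≤ (m : ℝ)) :
    (Measure.pi fun _ : Fin m => D)
      {S | ∃ u, IsBestFit a b S w u ∧ ¬ (1 / 768 * a ^ 2 * L * R ^ 4 / b * ‖perp v w‖ ^ 2
        - 2 * (sqLoss D v f + ε) / b - 2 * (√(sqLoss D v f) + √ε) * ‖w - v‖
        ≤ ⟪empSurrogateGrad S w u, w - v⟫)} ≤ ENNReal.ofReal δ := by
  obtain ⟨hm0, hmδ, hℓ1, hmℓ⟩ := sampleSize_bounds hd hL hL1 hb hε hε1 hδ hδ1 hm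
  have hP' : IsProbabilityMeasure (D.map Prod.fst) :=
    Measure.isProbabilityMeasure_map (by fun_prop)
  have hm' : (0 : ℝ) < m := by positivity
  have hb0 : 0 < b := by linarith
  clear hm
  set ℓ := Real.log (40 * m / (δ * L ^ 2)) with hℓ
  set V := max 1 W with hV
  have hV1 : 1 ≤ V := le_max_left _ _
  have hWV : W ≤ V := le_max_right _ _
  have hW0 : 0 ≤ W := (norm_nonneg _).trans hv
  set n := m * ε * δ with hn
  have hn0 : 0 < n := by positivity
  set s := 2 * ℓ / L with hs
  have hs0 : 0 < s := by positivity
  set B := V * s with hB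
  have hB0 : 0 < B := by positivity
  -- The largest truncation level for which the squared low part still concentrates; it also exceeds
  -- `80 * (b * B)`, as the high part requires.
  set M := √(n / 2800) with hM
  have hM0 : 0 < M := Real.sqrt_pos.2 (by positivity)
  have hM2 : M ^ 2 = n / 2800 := Real.sq_sqrt (by positivity)
  have hbB : 2 * 10 ^ 8 * (b * B) ^ 2 ≤ n := by
    have e : (b * B) ^ 2 = 4 * (b * V * ℓ) ^ 2 / L ^ 2 := by
      rw [hB, hs]; field_simp; norm_num
    rw [e, mul_div_assoc', div_le_iff₀ (by positivity)]
    nlinarith [sq_nonneg (b * V * ℓ)]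
  have hsn : 2 * 10 ^ 8 * s ^ 2 ≤ m * δ := by
    have h1 : s ^ 2 ≤ (b * B) ^ 2 := by
      refine pow_le_pow_left₀ hs0.le ?_ 2
      rw [hB, ← mul_assoc]
      exact le_mul_of_one_le_left hs0.le (one_le_mul_of_one_le_of_one_le hb hV1)
    have h2 : n ≤ m * δ := by
      rw [hn]
      have := mul_le_mul_of_nonneg_left hε1 (show 0 ≤ m * δ by positivity)
      linarith
    linarith
  have hbW : 2200 * (b * W) ^ 2 ≤ n := by
    have h1 : (b * W) ^ 2 ≤ (b * B) ^ 2 := by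
      refine pow_le_pow_left₀ (by positivity) ?_ 2
      have hs1 : 1 ≤ s := by
        rw [hs, le_div_iff₀ hL]; linarith
      rw [hB]
      refine mul_le_mul_of_nonneg_left (hWV.trans ?_) hb0.le
      exact le_mul_of_one_le_right (by positivity) hs1
    nlinarith [sq_nonneg (b * W)]
  have hBM : 80 * (b * B) ≤ M := by
    refine (le_abs_self _).trans (abs_le_of_sq_le_sq ?_ hM0.le)
    rw [hM2]
    nlinarith [sq_nonneg (b * B)]
  have hfc := continuous_of_mem_activations hf
  set ξ : EuclideanSpace ℝ (Fin d) × ℝ → ℝ := fun p => p.2 - f ⟪v, p.1⟫ with hξ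
  have hξm : Measurable ξ := by fun_prop
  have hξ2 : MemLp ξ 2 D := memLp_residual hL hP hy v hf
  set O := sqLoss D v f with hOdef
  have hO : ∫ p, ξ p ^ 2 ∂D = O := by
    rw [hOdef, sqLoss]
    refine integral_congr_ae (Filter.Eventually.of_forall fun p => ?_)
    simp only [hξ]
    ring
  set q : EuclideanSpace ℝ (Fin d) × ℝ → ℝ := fun p => ⟪w - v, p.1⟫ with hq
  have hN : 0 < ‖w - v‖ := norm_pos_iff.2 (sub_ne_zero.2 hwv)
  have hq2 : MemLp q 2 D := by simpa using memLp_inner hL hP (w - v) 1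
  have hqN : ∫ p, q p ^ 2 ∂D ≤ ‖w - v‖ ^ 2 := by
    have h := hS (w - v)
    rwa [integral_map (by fun_prop) (by fun_prop)] at h
  have h₁ := measure_lowPart_sq_deviation_le hm0 hξm hξ2 (M := M) hO hε hδ
    (by rw [hM2, ← hn]; linarith)
  obtain ⟨T₂, hT₂, h₂⟩ := measure_highPart_process_le (Z := fun p => ⟪w, p.1⟫) (a := a) hm0 hξm
    (by fun_prop) hξ2 hM0 hB0 hb0 hO hε hδ (by rw [← hn]; nlinarith [sq_nonneg (b * B)]) hBM
  obtain ⟨T₃, hT₃, h₃⟩ := measure_highPart_linear_le (M := M) (q := q) (s := s) hm0 hξm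
    (by fun_prop) hξ2 hq2 hN hqN hs0.le hO hε hδ (by nlinarith [sq_nonneg s])
  have h₄ := measure_sq_inner_le hm0 hL hP hS (sub_ne_zero.2 hwv) (δ := δ) (by linarith)
  obtain ⟨G, T₅, hG, hT₅, h₅⟩ := exists_empirical_error_bound hm0 hL hR hR1 ha hab hε hP hw hv hf
    hbW
  have h₆ := measure_exists_large_inner_le hm0 hL hP hδ w (r := B)
    (mul_le_mul_of_nonneg_right (hw.trans hWV) hs0.le)
  have h₇ := measure_exists_large_inner_le hm0 hL hP hδ (w - v) (r := ‖w - v‖ * s) le_rfl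
  set T₁ := {S : Fin m → EuclideanSpace ℝ (Fin d) × ℝ | (O + ε) / 40 ≤
      |(1 / (m : ℝ)) * ∑ i, lowPart M ξ (S i) ^ 2 - ∫ p, lowPart M ξ p ^ 2 ∂D|} with hT₁
  set T₄ := {S : Fin m → EuclideanSpace ℝ (Fin d) × ℝ |
    1.21 * ‖w - v‖ ^ 2 < (1 / (m : ℝ)) * ∑ i, ⟪w - v, (S i).1⟫ ^ 2} with hT₄
  set T₆ := {S : Fin m → EuclideanSpace ℝ (Fin d) × ℝ | ∃ i, S i ∈ {p | B < |⟪w, p.1⟫|}} with hT₆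
  set T₇ := {S : Fin m → EuclideanSpace ℝ (Fin d) × ℝ |
    ∃ i, S i ∈ {p | ‖w - v‖ * s < |⟪w - v, p.1⟫|}} with hT₇
  have hsub : {S : Fin m → EuclideanSpace ℝ (Fin d) × ℝ | ∃ u, IsBestFit a b S w u ∧
      ¬ (1 / 768 * a ^ 2 * L * R ^ 4 / b * ‖perp v w‖ ^ 2
        - 2 * (O + ε) / b - 2 * (√O + √ε) * ‖w - v‖ ≤ ⟪empSurrogateGrad S w u, w - v⟫)}
      ⊆ T₁ ∪ (T₂ ∪ (T₃ ∪ (T₄ ∪ (T₅ ∪ (T₆ ∪ T₇))))) := by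
    rintro S ⟨u, hu, hnot⟩
    by_contra hSn
    simp only [Set.mem_union, not_or] at hSn
    obtain ⟨g₁, g₂, g₃, g₄, g₅, g₆, g₇⟩ := hSn
    apply hnot
    simp only [hT₁, hT₄, hT₆, hT₇, Set.mem_ofPred_eq, not_le, not_lt, not_exists] at g₁ g₄ g₆ g₇
    have hqi : ∀ i, ⟪w, (S i).1⟫ - ⟪v, (S i).1⟫ = q (S i) := fun i =>
      (inner_sub_left w v (S i).1).symm
    have hE₁ : 0 ≤ ∫ p, lowPart M ξ p ^ 2 ∂D := integral_nonneg fun p => sq_nonneg _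
    have hE₂ : 0 ≤ ∫ p, highPart M ξ p ^ 2 ∂D := integral_nonneg fun p => sq_nonneg _
    have hsum := integral_lowPart_sq_add (M := M) hξm hξ2
    rw [hO] at hsum
    have key := alignment_of_controlled_noise (z := fun i => ⟪w, (S i).1⟫)
      (t := fun i => ⟪v, (S i).1⟫) (y := fun i => (S i).2) (ξ₁ := fun i => lowPart M ξ (S i))
      (ξ₂ := fun i => highPart M ξ (S i)) (G := G) ha hb0 hε.le hN.le hE₁ hE₂ hsum.le hu.1 hf
      (hu.sum_le hm0)
      (fun i => by
        have := lowPart_add_highPart M ξ (S i)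
        simp only [hξ] at this ⊢
        linarith)
      (by have := (abs_lt.1 g₁).2; linarith) (h₂ S g₂ g₆)
      (by simp_rw [hqi]; exact h₃ S g₃ g₇) (by simp_rw [hqi]; exact g₄) (h₅ S g₅)
    rw [inner_empSurrogateGrad]
    refine le_trans ?_ key
    have hO0 : 0 ≤ O := by linarith
    have hG' : 1 / b * (1 / 768 * a ^ 2 * L * R ^ 4 * ‖perp v w‖ ^ 2 - ε) ≤ 1 / b * G := by gcongr
    have e1 : 1 / b * (1 / 768 * a ^ 2 * L * R ^ 4 * ‖perp v w‖ ^ 2 - ε)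
        = 1 / 768 * a ^ 2 * L * R ^ 4 / b * ‖perp v w‖ ^ 2 - ε / b := by ring
    -- The `ε` given up in the error bound is absorbed by the additive term of the conclusion.
    have e2 : ε / b ≤ 2 * (O + ε) / b := by gcongr; linarith
    have e3 : 0 ≤ √ε * ‖w - v‖ := by positivity
    linarith
  refine (measure_mono hsub).trans ?_
  refine (measure_union_le _ _).trans ((add_le_add h₁ ((measure_union_le _ _).trans (add_le_add hT₂
    ((measure_union_le _ _).trans (add_le_add hT₃ ((measure_union_le _ _).trans (add_le_add h₄
    ((measure_union_le _ _).trans (add_le_add hT₅ ((measure_union_le _ _).trans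
    (add_le_add h₆ h₇))))))))))).trans ?_)
  -- Five events of probability `δ / 7` and two of probability `δ / 10` sum to less than `δ`.
  rw [← ENNReal.ofReal_add (by positivity) (by positivity),
    ← ENNReal.ofReal_add (by positivity) (by positivity),
    ← ENNReal.ofReal_add (by positivity) (by positivity),
    ← ENNReal.ofReal_add (by positivity) (by positivity),
    ← ENNReal.ofReal_add (by positivity) (by positivity),
    ← ENNReal.ofReal_add (by positivity) (by positivity)]
  exact ENNReal.ofReal_le_ofReal (by linarith)

end Main
end SIM

/-- There are universal constants `c, C > 0` such that the following holds with
`μ = c a² L R⁴ / b`. The probability statement bounds the (outer) measure of the set of samples for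
which the inequality fails for some empirical best-fit activation. -/
theorem proposition3p1 :
    ∃ c C : ℝ, 0 < c ∧ 0 < C ∧
      ∀ (d : ℕ) (L R a b W ε δ : ℝ)
        (_ : 0 < L) (_ : L ≤ 1) (_ : 0 < R) (_ : R ≤ 1)
        (_ : 0 < a) (_ : a ≤ b) (_ : 1 ≤ b) (_ : 0 < W)
        (_ : 0 < ε) (_ : ε ≤ 1) (_ : 0 < δ) (_ : δ ≤ 1 / 2)
        (D : MeasureTheory.Measure (EuclideanSpace ℝ (Fin d) × ℝ))
        [MeasureTheory.IsProbabilityMeasure D]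
        (_ : SIM.IsWellBehaved L R (D.map Prod.fst))
        (_ : SIM.SecondMomentLeOne (D.map Prod.fst))
        (_ : MeasureTheory.Integrable (fun p => p.2 ^ 2) D)
        (wstar : EuclideanSpace ℝ (Fin d)) (ustar : ℝ → ℝ)
        (_ : SIM.IsOptimal D a b W wstar ustar)
        (w : EuclideanSpace ℝ (Fin d)) (_ : ‖w‖ ≤ W)
        (m : ℕ)
        (_ : C * (d * max 1 W ^ (9 / 2 : ℝ) * b ^ 4 / L ^ 4 * Real.log (d / (ε * δ)) ^ 4
              * (1 / ε ^ (3 / 2 : ℝ) + 1 / (ε * δ))) ≤ (m : ℝ)),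
        MeasureTheory.Measure.pi (fun _ : Fin m => D)
          {S | ∃ uhat : ℝ → ℝ, SIM.IsBestFit a b S w uhat ∧
            ¬ (inner ℝ (SIM.empSurrogateGrad S w uhat) (w - wstar) ≥
                (c * a ^ 2 * L * R ^ 4 / b) * ‖SIM.perp wstar w‖ ^ 2
                  - 2 * (SIM.opt D a b W + ε) / b
                  - 2 * (Real.sqrt (SIM.opt D a b W) + Real.sqrt ε) * ‖w - wstar‖)}
          ≤ ENNReal.ofReal δ := by
  refine ⟨1 / 768, 10 ^ 24, by norm_num, by norm_num, ?_⟩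
  intro d L R a b W ε δ hL hL1 hR hR1 ha hab hb hW hε hε1 hδ hδ1 D _ hP hS hy v f hopt w hw m hm
  obtain ⟨hv, hf, hval⟩ := hopt
  rw [← hval]
  -- For `w = w*` the left side and the orthogonal component vanish, so the inequality is trivial.
  -- Otherwise `‖w - w*‖ > 0`, as the rescaled concentration bounds need, and `d ≥ 1`.
  rcases eq_or_ne w v with rfl | hwv
  · have hO : 0 ≤ SIM.sqLoss D w f := integral_nonneg fun p => sq_nonneg _
    have hperp : SIM.perp w w = 0 := by
      rcases eq_or_ne w 0 with rfl | h0
      · simp [SIM.perp]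
      · have : ‖w‖ ^ 2 ≠ 0 := pow_ne_zero 2 (norm_ne_zero_iff.2 h0)
        simp [SIM.perp, div_self this]
    have hneg : 0 ≤ 2 * (SIM.sqLoss D w f + ε) / b := by positivity
    refine le_trans (le_of_eq ?_) (zero_le (a := ENNReal.ofReal δ))
    convert measure_empty (μ := MeasureTheory.Measure.pi (fun _ : Fin m => D))
    refine Set.eq_empty_of_forall_notMem fun S => ?_
    rintro ⟨u, -, hnot⟩
    apply hnot
    simpa [hperp] using hneg
  · have hd : 1 ≤ d := by
      by_contra! h0
      obtain rfl : d = 0 := by omega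
      exact hwv (Subsingleton.elim _ _)
    exact SIM.measure_alignment_failure_le hd hL hL1 hR hR1 ha hab hb hε hε1 hδ hδ1 hP hS hy hv hf
      hw hwv hm
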